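/- **Setting.** Let $\mathcal S,\mathcal A$ be finite non-empty sets, $\mathcal P$ a transition kernel from $\mathcal S\times\mathcal A$ to $\mathcal S$, $\rho$ an initial state distribution, $\gamma\in(0,1)$. For a stationary policy $\pi$ let $\lambda^\pi(s,a)=\sum_{t\ge0}\gamma^t\,\mathbb P_{\rho,\pi}(s_t=s,a_t=a)$, and let $\Lambda=\{\lambda^\pi\}\subset\mathbb R^{\mathcal S\times\mathcal A}$ be the set of all these occupancy measures. Let $\pi_\theta(a|s)\propto\exp\psi(s,a;\theta)$, $\theta\in\mathbb R^d$, be a softmax parametrization, write $\lambda(\theta)=\lambda^{\pi_\theta}$, and let $F:\mathbb R^{\mathcal S\times\mathcal A}\to\mathbb R$ be differentiable. For a trajectory $\tau=(s_0,a_0,\dots,s_{H-1},a_{H-1})$ put $\lambda(\tau)=\sum_{h<H}\gamma^h\delta_{s_h,a_h}$, $g(\tau,\theta,r)=\sum_{t<H}\big(\sum_{h=t}^{H-1}\gamma^h r(s_h,a_h)\big)\nabla_\theta\log\pi_\theta(a_t|s_t)$ and $w(\tau|\theta',\theta)=\prod_{h<H}\pi_{\theta'}(a_h|s_h)/\pi_\theta(a_h|s_h)$.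 **Algorithm (N-VR-PG)**, with input $\theta_0,T,H,(\eta_t),(\alpha_t)$. Sample $\tau_0$ of length $H$ from $\pi_{\theta_0}$; set $\lambda_0=\lambda(\tau_0)$, $r_{-1}=r_0=\nabla F(\lambda_0)$, $d_0=g(\tau_0,\theta_0,r_0)$, $\theta_1=\theta_0+\alpha_0 d_0/\|d_0\|$ (with the step size of index $0$). For $t=1,\dots,T-1$: sample $\tau_t$ of length $H$ from $\pi_{\theta_t}$ and, with $w_t=w(\tau_t|\theta_{t-1},\theta_t)$, set $\lambda_t=\eta_t\lambda(\tau_t)+(1-\eta_t)\big(\lambda_{t-1}+(1-w_t)\lambda(\tau_t)\big)$, $r_t=\nabla F(\lambda_t)$, $d_t=\eta_t g(\tau_t,\theta_t,r_{t-1})+(1-\eta_t)\big(d_{t-1}+g(\tau_t,\theta_t,r_{t-1})-w_t\,g(\tau_t,\theta_{t-1},r_{t-2})\big)$, $\theta_{t+1}=\theta_t+\alpha_t d_t/\|d_t\|$. (If $d_t=0$, then $\theta_{t+1}=\theta_t$.) **Assumptions.** Let $l_\psi,L_\psi,l_\lambda,L_\lambda,L_{\lambda,\infty},\ell_\theta>0$.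 1. Each $\psi(s,a;\cdot)$ is $C^2$ with $\|\nabla\psi(s,a;\theta)\|\le l_\psi$ and $\|\nabla^2\psi(s,a;\theta)\|\le L_\psi$ for all $\theta$. 2. For all $\mu,\nu\in\mathbb R^{\mathcal S\times\mathcal A}$: $\|\nabla F(\mu)\|_\infty\le l_\lambda$ and $\|\nabla F(\mu)-\nabla F(\nu)\|_\infty\le\min\{L_\lambda\|\mu-\nu\|_2,\ L_{\lambda,\infty}\|\mu-\nu\|_1\}$. 3. $F$ is concave on $\Lambda$ (a convex set), and $\theta^*\in\mathbb R^d$ maximizes $\theta\mapsto F(\lambda(\theta))$ over $\mathbb R^d$; $F^\star=F(\lambda(\theta^*))$. 4. (Local bijection with parameter $\bar\epsilon$.) There is a set $\Theta\subset\mathbb R^d$ that almost surely contains the iterates $\theta_0,\dots,\theta_{T-1}$ (for instance $\Theta=\mathbb R^d$), such that for each $\theta\in\Theta$ there are sets $U_\theta\ni\theta$ in $\mathbb R^d$ and $V_\theta\ni\lambda(\theta)$ in $\Lambda$ for which $\lambda:U_\theta\to V_\theta$ is a bijection with $\ell_\theta$-Lipschitz inverse, and $(1-\epsilon)\lambda(\theta)+\epsilon\lambda(\theta^*)\in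 V_\theta$ for all $0<\epsilon\le\bar\epsilon$. **Theorem.** There is a constant $C$ depending only on $l_\psi,L_\psi,l_\lambda,L_\lambda,L_{\lambda,\infty},\ell_\theta$ such that the following holds for all $a,\gamma\in(0,1)$ and $\alpha_0>0$. Run N-VR-PG for $T\ge1$ iterations with the constant step sizes $\alpha_t=\alpha_0/(T+1)^a$, with $\eta_t=2/(t+1)$ and $H=\lceil\log(T+1)/(1-\gamma)\rceil$, and suppose that Assumptions 1–4 hold with $\bar\epsilon\ge\frac{\alpha_0(1-\gamma)}{2\ell_\theta(T+1)^a}$. Then, as $T\to\infty$, $$F^\star-\mathbb E[F(\lambda(\theta_T))]\le C\,\frac{\alpha_0^2}{(1-\gamma)^3(T+1)^{2a-3/2}}\qquad\text{for all }T\ge T_0,$$ where $T_0$ depends only on $a,\gamma,\alpha_0$ and the six constants above; and the same bound holds for every $T\ge1$ with $C$ replaced by a constant $K$ that may depend also on $a,\gamma,\alpha_0$. Moreover, let $a>3/4$ and $\alpha_0=(1-\gamma)^{3/2}$. Then for all sufficiently small $\varepsilon>0$ (depending on $a,\gamma$ and the six constants) there is a number of iterations $T_\varepsilon$, depending only on $\varepsilon,a,\gamma$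 and the six constants, whose total number $T_\varepsilon H$ of sampled state-action pairs is at most $C\,\varepsilon^{-2/(4a-3)}$, such that $F^\star-\mathbb E[F(\lambda(\theta_T))]\le\varepsilon$ for every $T\ge T_\varepsilon$ for which the assumptions hold. -/

import Mathlib

noncomputable section

namespace NVRPG

/-- Transition kernel and initial state distribution of a finite Markov decision process. The
discount factor and the utility function are passed separately. -/
structure MDP (S A : Type*) [Fintype S] where
  /-- `P s a s'` is the probability of moving from `s` to `s'` under the action `a`. -/
  P : S → A → S → ℝ
  P_nonneg : ∀ s a s', 0 ≤ P s a s'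
  P_sum : ∀ s a, ∑ s', P s a s' = 1
  /-- The initial state distribution. -/
  ρ : S → ℝ
  ρ_nonneg : ∀ s, 0 ≤ ρ s
  ρ_sum : ∑ s, ρ s = 1

/-- The parameter space `ℝ^d` with its Euclidean norm. -/
abbrev Param (d : ℕ) : Type := EuclideanSpace ℝ (Fin d)

/-- Vectors indexed by state-action pairs, with the Euclidean norm. -/
abbrev SAVec (S A : Type*) : Type _ := EuclideanSpace ℝ (S × A)

/-- Trajectories `(s_0, a_0, …, s_{H-1}, a_{H-1})` of length `H`. -/
abbrev Traj (S A : Type*) (H : ℕ) : Type _ := Fin H → S × A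

variable {S A : Type*} [Fintype S] [Fintype A] [DecidableEq S] [DecidableEq A] {d : ℕ}

/-- A stationary (randomized) policy, `π s a` being the probability of `a` in state `s`. -/
def IsPolicy (π : S → A → ℝ) : Prop :=
  (∀ s a, 0 ≤ π s a) ∧ ∀ s, ∑ a, π s a = 1

/-- Probability that the first `H` state-action pairs of the Markov chain with initial state
distribution `ρ` and policy `π` are `τ`. -/
def MDP.trajProb (M : MDP S A) (π : S → A → ℝ) : (H : ℕ) → Traj S A H → ℝ
  | 0, _ => 1
  | 1, τ => M.ρ (τ 0).1 * π (τ 0).1 (τ 0).2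
  | H + 2, τ =>
      M.trajProb π (H + 1) (Fin.init τ) *
        (M.P (τ (Fin.last H).castSucc).1 (τ (Fin.last H).castSucc).2 (τ (Fin.last (H + 1))).1 *
          π (τ (Fin.last (H + 1))).1 (τ (Fin.last (H + 1))).2)

/-- Probability that the state-action pair at time `t` is `x`. -/
def MDP.saProb (M : MDP S A) (π : S → A → ℝ) (t : ℕ) (x : S × A) : ℝ :=
  ∑ τ : Traj S A (t + 1), if τ (Fin.last t) = x then M.trajProb π (t + 1) τ else 0

/-- The discounted state-action occupancy measure of a policy. -/
def MDP.occupancy (M : MDP S A) (γ : ℝ) (π : S → A → ℝ) : SAVec S A :=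
  WithLp.toLp 2 fun x => ∑' t : ℕ, γ ^ t * M.saProb π t x

/-- The set of the occupancy measures of all stationary policies. -/
def MDP.occupancySet (M : MDP S A) (γ : ℝ) : Set (SAVec S A) :=
  {μ | ∃ π, IsPolicy π ∧ M.occupancy γ π = μ}

/-- The softmax policy with parameter `θ`. -/
def softmax (ψ : S → A → Param d → ℝ) (θ : Param d) (s : S) (a : A) : ℝ :=
  Real.exp (ψ s a θ) / ∑ b, Real.exp (ψ s b θ)

/-- The occupancy measure of the softmax policy with parameter `θ`. -/
def occ (M : MDP S A) (γ : ℝ) (ψ : S → A → Param d → ℝ) (θ : Param d) : SAVec S A :=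
  M.occupancy γ (softmax ψ θ)

/-- The truncated policy gradient estimate along `τ` for the reward vector `r`. -/
def pgEst (γ : ℝ) (ψ : S → A → Param d → ℝ) {H : ℕ} (τ : Traj S A H) (θ : Param d)
    (r : SAVec S A) : Param d :=
  ∑ t : Fin H, (∑ h ∈ Finset.Ici t, γ ^ (h : ℕ) * r (τ h)) •
    gradient (fun ϑ => Real.log (softmax ψ ϑ (τ t).1 (τ t).2)) θ

/-- The truncated occupancy measure estimate along `τ`. -/
def occEst (γ : ℝ) {H : ℕ} (τ : Traj S A H) : SAVec S A :=
  ∑ h : Fin H, γ ^ (h : ℕ) • EuclideanSpace.single (τ h) (1 : ℝ)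

/-- The importance sampling weight `w(τ | θ', θ)`. -/
def isWeight (ψ : S → A → Param d → ℝ) {H : ℕ} (τ : Traj S A H) (θ' θ : Param d) : ℝ :=
  ∏ h : Fin H, softmax ψ θ' (τ h).1 (τ h).2 / softmax ψ θ (τ h).1 (τ h).2

/-- The variables kept by the algorithm when `t` trajectories have been used. -/
structure State (S A : Type*) (d : ℕ) where
  /-- the iterate `θ_t` -/
  θ : Param d
  /-- the previous iterate `θ_{t-1}` -/
  θprev : Param d
  /-- the occupancy measure estimate `λ_{t-1}` -/
  lam : SAVec S A
  /-- the reward vector `r_{t-1}` -/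
  r : SAVec S A
  /-- the reward vector `r_{t-2}` -/
  rprev : SAVec S A
  /-- the direction `d_{t-1}` -/
  dir : Param d

/-- The normalized update; it leaves `θ` unchanged if the direction vanishes. -/
def normStep (α : ℝ) (θ v : Param d) : Param d :=
  θ + (α / ‖v‖) • v

/-- Iteration `t` of the algorithm, using the trajectory `τ = τ_t`. Iteration `0` only reads the
initial parameter from the given state. -/
def step (γ : ℝ) (ψ : S → A → Param d → ℝ) (F : SAVec S A → ℝ) (η α : ℕ → ℝ) {H : ℕ} :
    ℕ → State S A d → Traj S A H → State S A d
  | 0, s, τ =>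
      let lam := occEst γ τ
      let r := gradient F lam
      let dir := pgEst γ ψ τ s.θ r
      { θ := normStep (α 0) s.θ dir
        θprev := s.θ
        lam := lam
        r := r
        rprev := r
        dir := dir }
  | t + 1, s, τ =>
      let w := isWeight ψ τ s.θprev s.θ
      let u := (1 - w) • occEst γ τ
      let lam := η (t + 1) • occEst γ τ + (1 - η (t + 1)) • (s.lam + u)
      let v := pgEst γ ψ τ s.θ s.r - w • pgEst γ ψ τ s.θprev s.rprev
      let dir := η (t + 1) • pgEst γ ψ τ s.θ s.r + (1 - η (t + 1)) • (s.dir + v)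
      { θ := normStep (α (t + 1)) s.θ dir
        θprev := s.θ
        lam := lam
        r := gradient F lam
        rprev := s.r
        dir := dir }

/-- The state of the algorithm started at `θ₀` once the `n` trajectories `ω` have been used; its
component `θ` is the iterate `θ_n`. The zeros in the initial state are never read. -/
def run (γ : ℝ) (ψ : S → A → Param d → ℝ) (F : SAVec S A → ℝ) (η α : ℕ → ℝ) (H : ℕ)
    (θ₀ : Param d) : (n : ℕ) → (Fin n → Traj S A H) → State S A d
  | 0, _ => { θ := θ₀, θprev := θ₀, lam := 0, r := 0, rprev := 0, dir := 0 }
  | n + 1, ω => step γ ψ F η α n (run γ ψ F η α H θ₀ n (Fin.init ω)) (ω (Fin.last n))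

/-- Probability that the first `n` trajectories sampled by the algorithm are `ω`: given the past,
trajectory `t` is sampled from the process with the softmax policy of parameter `θ_t`. -/
def runProb (M : MDP S A) (γ : ℝ) (ψ : S → A → Param d → ℝ) (F : SAVec S A → ℝ) (η α : ℕ → ℝ)
    (H : ℕ) (θ₀ : Param d) : (n : ℕ) → (Fin n → Traj S A H) → ℝ
  | 0, _ => 1
  | n + 1, ω =>
      runProb M γ ψ F η α H θ₀ n (Fin.init ω) *
        M.trajProb (softmax ψ (run γ ψ F η α H θ₀ n (Fin.init ω)).θ) H (ω (Fin.last n))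

/-- The expected utility `𝔼[F(λ(θ_T))]` of the iterate `θ_T`. -/
def expectedUtility (M : MDP S A) (γ : ℝ) (ψ : S → A → Param d → ℝ) (F : SAVec S A → ℝ)
    (η α : ℕ → ℝ) (H : ℕ) (θ₀ : Param d) (T : ℕ) : ℝ :=
  ∑ ω : Fin T → Traj S A H,
    runProb M γ ψ F η α H θ₀ T ω * F (occ M γ ψ (run γ ψ F η α H θ₀ T ω).θ)

/-- The horizon `log (T + 1) / (1 - γ)`, rounded up. -/
def horizon (γ : ℝ) (T : ℕ) : ℕ := ⌈Real.log (T + 1) / (1 - γ)⌉₊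

/-- The momentum parameters `η_t = 2 / (t + 1)`. -/
def etaSeq (t : ℕ) : ℝ := 2 / ((t : ℝ) + 1)

/-- The constant step sizes `α_t = α₀ / (T + 1) ^ a`. -/
def alphaSeq (α₀ a : ℝ) (T : ℕ) (_t : ℕ) : ℝ := α₀ / ((T : ℝ) + 1) ^ a

/-- The optimality gap `F(λ(θs)) - 𝔼[F(λ(θ_T))]` after the `T` iterations of the algorithm with
`α_t = α₀ / (T + 1) ^ a`, `η_t = 2 / (t + 1)` and horizon `log (T + 1) / (1 - γ)`. -/
def optGap (M : MDP S A) (γ : ℝ) (ψ : S → A → Param d → ℝ) (F : SAVec S A → ℝ) (θ₀ θs : Param d)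
    (α₀ a : ℝ) (T : ℕ) : ℝ :=
  F (occ M γ ψ θs) -
    expectedUtility M γ ψ F etaSeq (alphaSeq α₀ a T) (horizon γ T) θ₀ T

/-- The rate `α₀² / ((1 - γ)³ (T + 1) ^ (2 a - 3 / 2))`. -/
def rate (α₀ γ a : ℝ) (T : ℕ) : ℝ :=
  α₀ ^ 2 / ((1 - γ) ^ 3 * ((T : ℝ) + 1) ^ (2 * a - 3 / 2))

/-- `Θ` contains, almost surely, the iterates `θ_0, …, θ_{T-1}` of that algorithm. -/
def IteratesIn (M : MDP S A) (γ : ℝ) (ψ : S → A → Param d → ℝ) (F : SAVec S A → ℝ) (θ₀ : Param d)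
    (α₀ a : ℝ) (T : ℕ) (Θ : Set (Param d)) : Prop :=
  ∀ t < T, ∀ ω : Fin t → Traj S A (horizon γ T),
    0 < runProb M γ ψ F etaSeq (alphaSeq α₀ a T) (horizon γ T) θ₀ t ω →
    (run γ ψ F etaSeq (alphaSeq α₀ a T) (horizon γ T) θ₀ t ω).θ ∈ Θ

/-- Regularity of the softmax parametrization. -/
structure PolicyRegular (ψ : S → A → Param d → ℝ) (lψ Lψ : ℝ) : Prop where
  contDiff : ∀ s a, ContDiff ℝ 2 (ψ s a)
  grad_le : ∀ s a θ, ‖gradient (ψ s a) θ‖ ≤ lψ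
  hess_le : ∀ s a θ, ‖fderiv ℝ (gradient (ψ s a)) θ‖ ≤ Lψ

/-- Regularity of the utility. The gradient of `F` is bounded in the sup norm, and Lipschitz from
the Euclidean norm and from the `ℓ¹` norm to the sup norm. The algorithm evaluates the gradient of
`F` at the estimates `λ_t`, which are arbitrary vectors. -/
structure UtilityRegular (F : SAVec S A → ℝ) (l L Linf : ℝ) : Prop where
  differentiable : Differentiable ℝ F
  grad_le : ∀ μ i, |gradient F μ i| ≤ l
  grad_lip : ∀ μ ν i, |gradient F μ i - gradient F ν i| ≤ L * ‖μ - ν‖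
  grad_lip_one : ∀ μ ν i, |gradient F μ i - gradient F ν i| ≤ Linf * ∑ j, |μ j - ν j|

/-- Local invertibility of `θ ↦ λ(θ)` at the parameters in `Θ`, with an `ℓ`-Lipschitz inverse on a
piece `V` of the set of occupancy measures that contains the beginning of the segment from `λ(θ)`
to `λ(θs)`. The sets `U` and `V` are not required to be open, so that redundant parametrizations
such as the tabular softmax are allowed. -/
def LocallyInvertible (M : MDP S A) (γ : ℝ) (ψ : S → A → Param d → ℝ) (θs : Param d)
    (Θ : Set (Param d)) (ℓ εbar : ℝ) : Prop :=
  ∀ θ ∈ Θ, ∃ (U : Set (Param d)) (V : Set (SAVec S A)),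
    θ ∈ U ∧ occ M γ ψ θ ∈ V ∧ V ⊆ M.occupancySet γ ∧
    Set.BijOn (occ M γ ψ) U V ∧
    (∀ x ∈ U, ∀ y ∈ U, ‖x - y‖ ≤ ℓ * ‖occ M γ ψ x - occ M γ ψ y‖) ∧
    ∀ ε : ℝ, 0 < ε → ε ≤ εbar → (1 - ε) • occ M γ ψ θ + ε • occ M γ ψ θs ∈ V

end NVRPG

end

/-!
Both recursive estimators are unbiased up to the truncation at the horizon, and each update changes
their error by a martingale increment whose variance is of order `η_t² + α²`, because consecutive
policies differ by `O(α)`. Hence with `η_t = 2 / (t + 1)` the mean errors are of order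
`1 / √T + α √T`, up to powers of the logarithm, throughout the second half of a run. Concavity in
the occupancy measure together with the local inverse gives a point at distance `α` from `θ_t` that
closes a fixed fraction `ε` of the gap, with `ε` of order `α`, and the normalized step is at least
as good up to `α` times the error of the direction. So the gap is contracted by `1 - ε` in each
step, its initial value is forgotten since `α T` grows like a power of `T`, and what remains is of
the order of the estimation error. As `a < 1`, this error beats the claimed rate by a power of `T`,
which absorbs all logarithms and constants.
-/

noncomputable section

namespace NVRPG

section Trajectories

variable {S A E : Type*} [Fintype S] [AddCommGroup E] [Module ℝ E]

lemma sum_fin_succ_snoc {X G : Type*} [Fintype X] [AddCommMonoid G] {n : ℕ}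
    (f : (Fin (n + 1) → X) → G) :
    ∑ ω, f ω = ∑ ω : Fin n → X, ∑ x, f (Fin.snoc ω x) := by
  rw [Finset.sum_comm, ← Fintype.sum_prod_type' (f := fun x (ω : Fin n → X) => f (Fin.snoc ω x))]
  exact (Fintype.sum_equiv (Fin.snocEquiv fun _ : Fin (n + 1) => X) _ _ fun _ => rfl).symm

/-- The distribution of the state at time `H` given the trajectory up to that time; for the empty
trajectory this is the initial state distribution. -/
def MDP.nextState (M : MDP S A) : (H : ℕ) → Traj S A H → S → ℝ
  | 0, _, s => M.ρ s
  | H + 1, τ, s => M.P (τ (Fin.last H)).1 (τ (Fin.last H)).2 s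

namespace MDP

variable (M : MDP S A) (H : ℕ)

lemma nextState_nonneg (τ : Traj S A H) (s : S) : 0 ≤ M.nextState H τ s := by
  cases H with
  | zero => exact M.ρ_nonneg s
  | succ H => exact M.P_nonneg _ _ s

lemma sum_nextState (τ : Traj S A H) : ∑ s, M.nextState H τ s = 1 := by
  cases H with
  | zero => exact M.ρ_sum
  | succ H => exact M.P_sum _ _

lemma trajProb_succ (π : S → A → ℝ) (τ : Traj S A (H + 1)) :
    M.trajProb π (H + 1) τ = M.trajProb π H (Fin.init τ) *
      (M.nextState H (Fin.init τ) (τ (Fin.last H)).1 *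
        π (τ (Fin.last H)).1 (τ (Fin.last H)).2) := by
  cases H with
  | zero => simp [trajProb, nextState]
  | succ H => rfl

lemma trajProb_snoc (π : S → A → ℝ) (τ : Traj S A H) (x : S × A) :
    M.trajProb π (H + 1) (Fin.snoc τ x : Traj S A (H + 1)) =
      M.trajProb π H τ * (M.nextState H τ x.1 * π x.1 x.2) := by
  simp [M.trajProb_succ]

variable [Fintype A] {π π' : S → A → ℝ}

lemma trajProb_nonneg (hπ : IsPolicy π) (τ : Traj S A H) : 0 ≤ M.trajProb π H τ := by
  induction H with
  | zero => simp [trajProb]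
  | succ H ih =>
    rw [M.trajProb_succ]
    exact mul_nonneg (ih _) (mul_nonneg (M.nextState_nonneg _ _ _) (hπ.1 _ _))

lemma sum_trajProb_succ_smul (π : S → A → ℝ) (f : Traj S A (H + 1) → E) :
    ∑ τ, M.trajProb π (H + 1) τ • f τ =
      ∑ τ, M.trajProb π H τ • ∑ s, M.nextState H τ s • ∑ a, π s a •
        f (Fin.snoc τ (s, a) : Traj S A (H + 1)) := by
  simp only [sum_fin_succ_snoc, Fintype.sum_prod_type, Finset.smul_sum, M.trajProb_snoc, smul_smul]

lemma sum_trajProb_smul_init (hπ : IsPolicy π) (f : Traj S A H → E) :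
    ∑ τ, M.trajProb π (H + 1) τ • f (Fin.init τ) = ∑ τ, M.trajProb π H τ • f τ := by
  simp [M.sum_trajProb_succ_smul, ← Finset.sum_smul, hπ.2, M.sum_nextState]

lemma sum_trajProb (hπ : IsPolicy π) : ∑ τ, M.trajProb π H τ = 1 := by
  induction H with
  | zero => simp [trajProb]
  | succ H ih => simpa [ih] using M.sum_trajProb_smul_init H hπ (fun _ => (1 : ℝ))

lemma sum_abs_trajProb_snoc_sub_le (hπ : IsPolicy π) (hπ' : IsPolicy π') {D : ℝ}
    (hD : ∀ s, ∑ a, |π' s a - π s a| ≤ D) (τ : Traj S A H) :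
    ∑ x : S × A, |M.trajProb π' (H + 1) (Fin.snoc τ x : Traj S A (H + 1)) -
        M.trajProb π (H + 1) (Fin.snoc τ x : Traj S A (H + 1))| ≤
      |M.trajProb π' H τ - M.trajProb π H τ| + M.trajProb π H τ * D := by
  have h_pair (x : S × A) : |M.trajProb π' (H + 1) (Fin.snoc τ x : Traj S A (H + 1)) -
        M.trajProb π (H + 1) (Fin.snoc τ x : Traj S A (H + 1))| ≤
      |M.trajProb π' H τ - M.trajProb π H τ| * (M.nextState H τ x.1 * π' x.1 x.2) +
        M.trajProb π H τ * (M.nextState H τ x.1 * |π' x.1 x.2 - π x.1 x.2|) := by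
    have h_split : M.trajProb π' (H + 1) (Fin.snoc τ x : Traj S A (H + 1)) -
          M.trajProb π (H + 1) (Fin.snoc τ x : Traj S A (H + 1)) =
        (M.trajProb π' H τ - M.trajProb π H τ) * (M.nextState H τ x.1 * π' x.1 x.2) +
          M.trajProb π H τ * (M.nextState H τ x.1 * (π' x.1 x.2 - π x.1 x.2)) := by
      rw [M.trajProb_snoc, M.trajProb_snoc]
      ring
    rw [h_split]
    refine (abs_add_le _ _).trans (le_of_eq ?_)
    simp only [abs_mul, abs_of_nonneg (M.nextState_nonneg H τ x.1), abs_of_nonneg (hπ'.1 x.1 x.2),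
      abs_of_nonneg (M.trajProb_nonneg H hπ τ)]
  have h_step : ∑ s, M.nextState H τ s * ∑ a, |π' s a - π s a| ≤ D :=
    calc ∑ s, M.nextState H τ s * ∑ a, |π' s a - π s a|
        ≤ ∑ s, M.nextState H τ s * D := by
          gcongr with s
          exacts [M.nextState_nonneg H τ s, hD s]
      _ = D := by rw [← Finset.sum_mul, M.sum_nextState, one_mul]
  calc _ ≤ _ := Finset.sum_le_sum fun x _ => h_pair x
    _ = |M.trajProb π' H τ - M.trajProb π H τ| +
        M.trajProb π H τ * ∑ s, M.nextState H τ s * ∑ a, |π' s a - π s a| := by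
      simp only [Finset.sum_add_distrib, ← Finset.mul_sum, Fintype.sum_prod_type, hπ'.2, mul_one,
        M.sum_nextState]
    _ ≤ _ := by gcongr; exact M.trajProb_nonneg H hπ τ

lemma sum_abs_trajProb_sub_le (hπ : IsPolicy π) (hπ' : IsPolicy π') {D : ℝ}
    (hD : ∀ s, ∑ a, |π' s a - π s a| ≤ D) :
    ∑ τ, |M.trajProb π' H τ - M.trajProb π H τ| ≤ H * D := by
  induction H with
  | zero => simp [trajProb]
  | succ H ih =>
    calc ∑ τ, |M.trajProb π' (H + 1) τ - M.trajProb π (H + 1) τ|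
        ≤ ∑ τ : Traj S A H,
          (|M.trajProb π' H τ - M.trajProb π H τ| + M.trajProb π H τ * D) := by
          rw [sum_fin_succ_snoc]
          exact Finset.sum_le_sum fun τ _ => M.sum_abs_trajProb_snoc_sub_le H hπ hπ' hD τ
      _ = ∑ τ, |M.trajProb π' H τ - M.trajProb π H τ| + D := by
          rw [Finset.sum_add_distrib, ← Finset.sum_mul, M.sum_trajProb H hπ, one_mul]
      _ ≤ (H + 1 : ℕ) * D := by
          push_cast
          linarith

lemma sum_trajProb_smul_past_smul_score (hπ : IsPolicy π) {u : S × A → E}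
    (hu : ∀ s, ∑ a, π s a • u (s, a) = 0) (f : ℕ → S × A → ℝ) :
    ∑ τ : Traj S A H, M.trajProb π H τ •
      ∑ t : Fin H, (∑ h ∈ Finset.Iio t, f h (τ h)) • u (τ t) = 0 := by
  induction H with
  | zero => simp
  | succ H ih =>
    have h_last (τ : Traj S A (H + 1)) :
        ∑ t : Fin (H + 1), (∑ h ∈ Finset.Iio t, f h (τ h)) • u (τ t) =
          ∑ t : Fin H, (∑ h ∈ Finset.Iio t, f h (Fin.init τ h)) • u (Fin.init τ t) +
          (∑ h : Fin H, f h (Fin.init τ h)) • u (τ (Fin.last H)) := by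
      have : Finset.Iio (Fin.last H) = Finset.univ.map Fin.castSuccEmb := by
        ext; simp
      simp [Fin.sum_univ_castSucc, ← Fin.map_castSuccEmb_Iio, Fin.init, this]
    have h_centered (c : ℝ) (s : S) : ∑ a, π s a • c • u (s, a) = 0 := by
      simp_rw [smul_comm _ c, ← Finset.smul_sum, hu, smul_zero]
    simp only [h_last, smul_add, Finset.sum_add_distrib]
    rw [M.sum_trajProb_smul_init H hπ
      (fun τ => ∑ t : Fin H, (∑ h ∈ Finset.Iio t, f h (τ h)) • u (τ t)), ih,
      M.sum_trajProb_succ_smul]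
    simp [h_centered]

lemma sum_trajProb_smul_return_smul_score (hπ : IsPolicy π) {u : S × A → E}
    (hu : ∀ s, ∑ a, π s a • u (s, a) = 0) (f : ℕ → S × A → ℝ) :
    ∑ τ : Traj S A H, M.trajProb π H τ • ((∑ h : Fin H, f h (τ h)) • ∑ t, u (τ t)) =
      ∑ τ : Traj S A H, M.trajProb π H τ •
        ∑ t : Fin H, (∑ h ∈ Finset.Ici t, f h (τ h)) • u (τ t) := by
  have h_split (τ : Traj S A H) : (∑ h : Fin H, f h (τ h)) • ∑ t, u (τ t) =
      ∑ t : Fin H, (∑ h ∈ Finset.Iio t, f h (τ h)) • u (τ t) +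
        ∑ t : Fin H, (∑ h ∈ Finset.Ici t, f h (τ h)) • u (τ t) := by
    rw [Finset.smul_sum, ← Finset.sum_add_distrib]
    refine Finset.sum_congr rfl fun t _ => ?_
    rw [← add_smul, ← Finset.sum_union (Finset.disjoint_left.2 fun h => by simp)]
    congr 2
    ext h
    simp [lt_or_ge]
  simp only [h_split, smul_add, Finset.sum_add_distrib,
    M.sum_trajProb_smul_past_smul_score H hπ hu, zero_add]

end MDP

end Trajectories

section Gradient

variable {E : Type*} [NormedAddCommGroup E] [InnerProductSpace ℝ E] [CompleteSpace E]
  {f : E → ℝ} {g : E → E} {C : ℝ}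

lemma abs_sub_le_of_hasGradientAt (hf : ∀ x, HasGradientAt f (g x) x) (hg : ∀ x, ‖g x‖ ≤ C)
    (x y : E) : |f y - f x| ≤ C * ‖y - x‖ :=
  convex_univ.norm_image_sub_le_of_norm_hasFDerivWithin_le
    (fun z _ => (hf z).hasFDerivAt.hasFDerivWithinAt)
    (fun z _ => by simpa only [LinearIsometryEquiv.norm_map] using hg z)
    (Set.mem_univ x) (Set.mem_univ y)

lemma abs_sub_sub_inner_le_of_hasGradientAt (hC : 0 ≤ C) (hf : ∀ x, HasGradientAt f (g x) x)
    (hg : ∀ x y, ‖g y - g x‖ ≤ C * ‖y - x‖) (x y : E) :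
    |f y - f x - inner ℝ (g x) (y - x)| ≤ C * ‖y - x‖ ^ 2 := by
  have h_bound (z : E) (hz : z ∈ Metric.closedBall x ‖y - x‖) :
      ‖InnerProductSpace.toDual ℝ E (g z) - InnerProductSpace.toDual ℝ E (g x)‖ ≤
        C * ‖y - x‖ := by
    rw [← map_sub, LinearIsometryEquiv.norm_map]
    exact (hg x z).trans (mul_le_mul_of_nonneg_left (by simpa [dist_eq_norm] using hz) hC)
  have h := (convex_closedBall x ‖y - x‖).norm_image_sub_le_of_norm_hasFDerivWithin_le'
    (fun z _ => (hf z).hasFDerivAt.hasFDerivWithinAt) h_bound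
    (Metric.mem_closedBall_self (norm_nonneg _))
    (show y ∈ Metric.closedBall x ‖y - x‖ by simp [dist_eq_norm])
  rwa [InnerProductSpace.toDual_apply_apply, mul_assoc, ← sq] at h

end Gradient

lemma norm_sum_smul_le {ι E : Type*} [Fintype ι] [SeminormedAddCommGroup E] [NormedSpace ℝ E]
    {p : ι → ℝ} {f : ι → E} {C : ℝ} (hf : ∀ i, ‖f i‖ ≤ C) :
    ‖∑ i, p i • f i‖ ≤ (∑ i, |p i|) * C := by
  rw [Finset.sum_mul]
  refine norm_sum_le_of_le _ fun i _ => ?_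
  rw [norm_smul, Real.norm_eq_abs]
  exact mul_le_mul_of_nonneg_left (hf i) (abs_nonneg _)

namespace PolicyRegular

variable {S A : Type*} {d : ℕ} {ψ : S → A → Param d → ℝ} {l L : ℝ} (hψ : PolicyRegular ψ l L)
include hψ

lemma differentiable (s : S) (a : A) : Differentiable ℝ (ψ s a) :=
  (hψ.contDiff s a).differentiable two_ne_zero

lemma norm_gradient_sub_le (θ θ' : Param d) (s : S) (a : A) :
    ‖gradient (ψ s a) θ' - gradient (ψ s a) θ‖ ≤ L * ‖θ' - θ‖ := by
  have h_diff : Differentiable ℝ (gradient (ψ s a)) :=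
    (LinearIsometryEquiv.differentiable _).comp
      (((hψ.contDiff s a).fderiv_right (m := 1) (by norm_num)).differentiable one_ne_zero)
  exact convex_univ.norm_image_sub_le_of_norm_fderiv_le (𝕜 := ℝ) (fun z _ => h_diff z)
    (fun z _ => hψ.hess_le s a z) (Set.mem_univ _) (Set.mem_univ _)

end PolicyRegular

section Softmax

variable {S A : Type*} [Fintype A] {d : ℕ}

/-- The score `∇ log π_θ(a | s)`. -/
def score (ψ : S → A → Param d → ℝ) (θ : Param d) (x : S × A) : Param d :=
  gradient (fun ϑ => Real.log (softmax ψ ϑ x.1 x.2)) θ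

variable [Nonempty A] (ψ : S → A → Param d → ℝ) (θ θ' : Param d) (s : S) (a : A)

lemma sum_exp_pos : 0 < ∑ b, Real.exp (ψ s b θ) :=
  Finset.sum_pos (fun _ _ => Real.exp_pos _) Finset.univ_nonempty

lemma softmax_pos : 0 < softmax ψ θ s a :=
  div_pos (Real.exp_pos _) (sum_exp_pos ψ θ s)

lemma sum_softmax : ∑ a, softmax ψ θ s a = 1 := by
  simp only [softmax]
  rw [← Finset.sum_div, div_self (sum_exp_pos ψ θ s).ne']

lemma sum_abs_softmax : ∑ a, |softmax ψ θ s a| = 1 := by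
  simp only [abs_of_pos (softmax_pos ψ θ s _), sum_softmax]

lemma isPolicy_softmax : IsPolicy (softmax ψ θ) :=
  ⟨fun s a => (softmax_pos ψ θ s a).le, sum_softmax ψ θ⟩

lemma log_softmax :
    Real.log (softmax ψ θ s a) = ψ s a θ - Real.log (∑ b, Real.exp (ψ s b θ)) := by
  rw [softmax, Real.log_div (Real.exp_pos _).ne' (sum_exp_pos ψ θ s).ne', Real.log_exp]

variable {ψ}

lemma hasGradientAt_log_softmax_sub (hψ : ∀ s a, Differentiable ℝ (ψ s a)) :
    HasGradientAt (fun ϑ => Real.log (softmax ψ ϑ s a))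
      (gradient (ψ s a) θ - ∑ b, softmax ψ θ s b • gradient (ψ s b) θ) θ := by
  have h_fderiv (b : A) : HasFDerivAt (ψ s b) (fderiv ℝ (ψ s b) θ) θ := (hψ s b θ).hasFDerivAt
  have h_dual : InnerProductSpace.toDual ℝ (Param d)
      (gradient (ψ s a) θ - ∑ b, softmax ψ θ s b • gradient (ψ s b) θ) =
      fderiv ℝ (ψ s a) θ - (∑ b, Real.exp (ψ s b θ))⁻¹ •
        ∑ b, Real.exp (ψ s b θ) • fderiv ℝ (ψ s b) θ := by
    simp [toDual_gradient, Finset.smul_sum, smul_smul, softmax, div_eq_inv_mul]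
  simp only [log_softmax]
  rw [hasGradientAt_iff_hasFDerivAt, h_dual]
  exact (h_fderiv a).sub ((HasFDerivAt.fun_sum fun b _ => (h_fderiv b).exp).log
    (sum_exp_pos ψ θ s).ne')

lemma score_eq (hψ : ∀ s a, Differentiable ℝ (ψ s a)) :
    score ψ θ (s, a) = gradient (ψ s a) θ - ∑ b, softmax ψ θ s b • gradient (ψ s b) θ :=
  (hasGradientAt_log_softmax_sub θ s a hψ).gradient

lemma hasGradientAt_log_softmax (hψ : ∀ s a, Differentiable ℝ (ψ s a)) :
    HasGradientAt (fun ϑ => Real.log (softmax ψ ϑ s a)) (score ψ θ (s, a)) θ :=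
  (hasGradientAt_log_softmax_sub θ s a hψ).differentiableAt.hasGradientAt

lemma hasGradientAt_softmax (hψ : ∀ s a, Differentiable ℝ (ψ s a)) :
    HasGradientAt (fun ϑ => softmax ψ ϑ s a) (softmax ψ θ s a • score ψ θ (s, a)) θ := by
  have h := (hasGradientAt_log_softmax θ s a hψ).hasFDerivAt.exp
  simp only [Real.exp_log (softmax_pos ψ _ s a)] at h
  rw [hasGradientAt_iff_hasFDerivAt]
  simpa using h

lemma sum_softmax_smul_score (hψ : ∀ s a, Differentiable ℝ (ψ s a)) :
    ∑ a, softmax ψ θ s a • score ψ θ (s, a) = 0 := by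
  simp only [score_eq _ _ _ hψ, smul_sub, Finset.sum_sub_distrib]
  rw [← Finset.sum_smul, sum_softmax, one_smul, sub_self]

namespace PolicyRegular

variable {l L : ℝ} (hψ : PolicyRegular ψ l L)
include hψ

lemma norm_score_le (x : S × A) : ‖score ψ θ x‖ ≤ 2 * l := by
  have h_mean := norm_sum_smul_le (p := softmax ψ θ x.1) (hψ.grad_le x.1 · θ)
  rw [sum_abs_softmax, one_mul] at h_mean
  rw [score_eq _ _ _ hψ.differentiable, two_mul]
  exact (norm_sub_le _ _).trans (add_le_add (hψ.grad_le _ _ _) h_mean)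

lemma abs_log_softmax_sub_le :
    |Real.log (softmax ψ θ' s a) - Real.log (softmax ψ θ s a)| ≤ 2 * l * ‖θ' - θ‖ :=
  abs_sub_le_of_hasGradientAt (fun ϑ => hasGradientAt_log_softmax ϑ s a hψ.differentiable)
    (fun ϑ => hψ.norm_score_le ϑ (s, a)) θ θ'

lemma sum_abs_softmax_sub_le :
    ∑ a, |softmax ψ θ' s a - softmax ψ θ s a| ≤ 2 * l * ‖θ' - θ‖ := by
  set σ : A → ℝ := fun a => SignType.sign (softmax ψ θ' s a - softmax ψ θ s a) with hσ
  have h_signed (ϑ : Param d) : HasGradientAt (fun ϑ => ∑ a, σ a * softmax ψ ϑ s a)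
      (∑ a, (σ a * softmax ψ ϑ s a) • score ψ ϑ (s, a)) ϑ := by
    rw [hasGradientAt_iff_hasFDerivAt]
    simpa [smul_smul] using HasFDerivAt.fun_sum (u := Finset.univ) fun a _ =>
      (hasGradientAt_softmax ϑ s a hψ.differentiable).hasFDerivAt.const_mul (σ a)
  have h_l : 0 ≤ 2 * l := (norm_nonneg _).trans (hψ.norm_score_le θ (s, Classical.arbitrary A))
  have h_bound (ϑ : Param d) : ‖∑ a, (σ a * softmax ψ ϑ s a) • score ψ ϑ (s, a)‖ ≤ 2 * l := by
    refine (norm_sum_smul_le fun a => hψ.norm_score_le ϑ (s, a)).trans ?_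
    refine mul_le_of_le_one_left h_l ?_
    rw [← sum_abs_softmax ψ ϑ s]
    refine Finset.sum_le_sum fun a _ => ?_
    rw [abs_mul]
    refine mul_le_of_le_one_left (abs_nonneg _) ?_
    rcases SignType.trichotomy (SignType.sign (softmax ψ θ' s a - softmax ψ θ s a)) with
      h | h | h <;> simp [hσ, h]
  calc ∑ a, |softmax ψ θ' s a - softmax ψ θ s a|
      = ∑ a, σ a * softmax ψ θ' s a - ∑ a, σ a * softmax ψ θ s a := by
        simp only [← Finset.sum_sub_distrib, ← mul_sub, hσ, sign_mul_self]
    _ ≤ 2 * l * ‖θ' - θ‖ :=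
        (le_abs_self _).trans (abs_sub_le_of_hasGradientAt h_signed h_bound θ θ')

lemma norm_score_sub_le (x : S × A) :
    ‖score ψ θ' x - score ψ θ x‖ ≤ 2 * (L + l ^ 2) * ‖θ' - θ‖ := by
  obtain ⟨s, a⟩ := x
  have h_split : score ψ θ' (s, a) - score ψ θ (s, a) =
      (gradient (ψ s a) θ' - gradient (ψ s a) θ) -
      ∑ b, (softmax ψ θ' s b - softmax ψ θ s b) • gradient (ψ s b) θ' -
      ∑ b, softmax ψ θ s b • (gradient (ψ s b) θ' - gradient (ψ s b) θ) := by
    simp only [score_eq _ _ _ hψ.differentiable, sub_smul, smul_sub, Finset.sum_sub_distrib]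
    abel
  have h_grad := hψ.norm_gradient_sub_le θ θ' s a
  have h_policy : ‖∑ b, (softmax ψ θ' s b - softmax ψ θ s b) • gradient (ψ s b) θ'‖ ≤
      2 * l * ‖θ' - θ‖ * l :=
    (norm_sum_smul_le (hψ.grad_le s · θ')).trans (mul_le_mul_of_nonneg_right
      (hψ.sum_abs_softmax_sub_le θ θ' s) ((norm_nonneg _).trans (hψ.grad_le s a θ)))
  have h_mean : ‖∑ b, softmax ψ θ s b • (gradient (ψ s b) θ' - gradient (ψ s b) θ)‖ ≤
      L * ‖θ' - θ‖ := by
    simpa only [sum_abs_softmax, one_mul] using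
      norm_sum_smul_le (p := softmax ψ θ s) (hψ.norm_gradient_sub_le θ θ' s)
  rw [h_split]
  linarith [norm_sub_le_of_le (norm_sub_le_of_le h_grad h_policy) h_mean]

lemma abs_log_softmax_sub_sub_inner_le (x : S × A) :
    |Real.log (softmax ψ θ' x.1 x.2) - Real.log (softmax ψ θ x.1 x.2) -
      inner ℝ (score ψ θ x) (θ' - θ)| ≤ 2 * (L + l ^ 2) * ‖θ' - θ‖ ^ 2 := by
  have hL : 0 ≤ L := (norm_nonneg _).trans (hψ.hess_le x.1 x.2 θ)
  exact abs_sub_sub_inner_le_of_hasGradientAt (by positivity)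
    (fun ϑ => hasGradientAt_log_softmax ϑ x.1 x.2 hψ.differentiable)
    (fun ϑ ϑ' => hψ.norm_score_sub_le ϑ ϑ' x) θ θ'

end PolicyRegular

end Softmax

section ImportanceWeight

variable {S A : Type*} [Fintype A] [Nonempty A] {d H : ℕ}

lemma isWeight_eq_exp (ψ : S → A → Param d → ℝ) (τ : Traj S A H) (θ' θ : Param d) :
    isWeight ψ τ θ' θ = Real.exp (∑ h, (Real.log (softmax ψ θ' (τ h).1 (τ h).2) -
      Real.log (softmax ψ θ (τ h).1 (τ h).2))) := by
  rw [Real.exp_sum, isWeight]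
  refine Finset.prod_congr rfl fun h _ => ?_
  rw [Real.exp_sub, Real.exp_log (softmax_pos _ _ _ _), Real.exp_log (softmax_pos _ _ _ _)]

lemma MDP.trajProb_mul_isWeight [Fintype S] (M : MDP S A) (ψ : S → A → Param d → ℝ)
    (τ : Traj S A H) (θ' θ : Param d) :
    M.trajProb (softmax ψ θ) H τ * isWeight ψ τ θ' θ = M.trajProb (softmax ψ θ') H τ := by
  induction H with
  | zero => simp [MDP.trajProb, isWeight]
  | succ H ih =>
    rw [M.trajProb_succ, M.trajProb_succ, ← ih (Fin.init τ), isWeight, isWeight,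
      Fin.prod_univ_castSucc]
    have := (softmax_pos ψ θ (τ (Fin.last H)).1 (τ (Fin.last H)).2).ne'
    simp only [Fin.init]
    field_simp

namespace PolicyRegular

variable {ψ : S → A → Param d → ℝ} {l L : ℝ} (hψ : PolicyRegular ψ l L) (τ : Traj S A H)
  {θ' θ : Param d}
include hψ

lemma abs_sum_log_softmax_sub_le :
    |∑ h, (Real.log (softmax ψ θ' (τ h).1 (τ h).2) -
      Real.log (softmax ψ θ (τ h).1 (τ h).2))| ≤ 2 * H * l * ‖θ' - θ‖ := by
  refine (Finset.abs_sum_le_sum_abs _ _).trans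
    ((Finset.sum_le_sum fun h _ => hψ.abs_log_softmax_sub_le θ θ' _ _).trans_eq ?_)
  simp
  ring

lemma abs_isWeight_sub_one_le (h : 2 * H * l * ‖θ' - θ‖ ≤ 1) :
    |isWeight ψ τ θ' θ - 1| ≤ 4 * H * l * ‖θ' - θ‖ := by
  have h_log := hψ.abs_sum_log_softmax_sub_le τ (θ' := θ') (θ := θ)
  rw [isWeight_eq_exp]
  linarith [Real.abs_exp_sub_one_le (h_log.trans h)]

lemma abs_isWeight_sub_one_sub_inner_le (h : 2 * H * l * ‖θ' - θ‖ ≤ 1) :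
    |isWeight ψ τ θ' θ - 1 - inner ℝ (∑ t, score ψ θ (τ t)) (θ' - θ)| ≤
      (2 * H * (L + l ^ 2) + (2 * H * l) ^ 2) * ‖θ' - θ‖ ^ 2 := by
  set X := ∑ h, (Real.log (softmax ψ θ' (τ h).1 (τ h).2) -
    Real.log (softmax ψ θ (τ h).1 (τ h).2)) with hX
  have h_log : |X| ≤ 2 * H * l * ‖θ' - θ‖ := hψ.abs_sum_log_softmax_sub_le τ
  have h_exp : |Real.exp X - 1 - X| ≤ (2 * H * l * ‖θ' - θ‖) ^ 2 :=
    (Real.abs_exp_sub_one_sub_id_le (h_log.trans h)).trans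
      (sq_le_sq.2 (h_log.trans (le_abs_self _)))
  have h_lin : |X - inner ℝ (∑ t, score ψ θ (τ t)) (θ' - θ)| ≤
      H * (2 * (L + l ^ 2) * ‖θ' - θ‖ ^ 2) := by
    rw [sum_inner, hX, ← Finset.sum_sub_distrib]
    refine (Finset.abs_sum_le_sum_abs _ _).trans ((Finset.sum_le_sum fun h _ =>
      hψ.abs_log_softmax_sub_sub_inner_le θ θ' (τ h)).trans_eq ?_)
    simp
  rw [isWeight_eq_exp, ← sub_add_sub_cancel _ X]
  refine (abs_add_le _ _).trans ((add_le_add h_exp h_lin).trans_eq ?_)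
  ring

end PolicyRegular

end ImportanceWeight

section Utility

variable {ι : Type*} [Fintype ι]

/-- The `ℓ¹` norm of a vector, as opposed to the Euclidean norm carried by its type. -/
def l1 (v : EuclideanSpace ℝ ι) : ℝ := ∑ i, |v i|

lemma l1_nonneg (v : EuclideanSpace ℝ ι) : 0 ≤ l1 v := Finset.sum_nonneg fun _ _ => abs_nonneg _

lemma l1_sub_le (v w : EuclideanSpace ℝ ι) : l1 (v - w) ≤ l1 v + l1 w := by
  rw [l1, l1, l1, ← Finset.sum_add_distrib]
  exact Finset.sum_le_sum fun i _ => abs_sub _ _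

lemma l1_smul (c : ℝ) (v : EuclideanSpace ℝ ι) : l1 (c • v) = |c| * l1 v := by
  simp [l1, Finset.mul_sum, abs_mul]

lemma l1_sum_le {κ : Type*} (s : Finset κ) (v : κ → EuclideanSpace ℝ ι) :
    l1 (∑ k ∈ s, v k) ≤ ∑ k ∈ s, l1 (v k) := by
  simp only [l1]
  rw [Finset.sum_comm]
  refine Finset.sum_le_sum fun i _ => ?_
  simp only [WithLp.ofLp_sum, Finset.sum_apply]
  exact Finset.abs_sum_le_sum_abs _ _

lemma norm_le_l1 (v : EuclideanSpace ℝ ι) : ‖v‖ ≤ l1 v := by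
  rw [EuclideanSpace.norm_eq]
  refine Real.sqrt_le_iff.2 ⟨l1_nonneg v, ?_⟩
  simp only [Real.norm_eq_abs]
  exact Finset.sum_sq_le_sq_sum_of_nonneg fun _ _ => abs_nonneg _

lemma abs_inner_le_mul_l1 {r : EuclideanSpace ℝ ι} {c : ℝ} (hr : ∀ i, |r i| ≤ c)
    (v : EuclideanSpace ℝ ι) : |inner ℝ r v| ≤ c * l1 v := by
  rw [PiLp.inner_apply, l1, Finset.mul_sum]
  refine (Finset.abs_sum_le_sum_abs _ _).trans (Finset.sum_le_sum fun i _ => ?_)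
  simp only [RCLike.inner_apply, conj_trivial, abs_mul, mul_comm |v i|]
  exact mul_le_mul_of_nonneg_right (hr i) (abs_nonneg _)

lemma l1_sub_le_of_mem_segment {μ ν z : EuclideanSpace ℝ ι} (hz : z ∈ segment ℝ ν μ) :
    l1 (z - ν) ≤ l1 (μ - ν) := by
  rw [segment_eq_image'] at hz
  obtain ⟨t, ⟨ht0, ht1⟩, rfl⟩ := hz
  rw [add_sub_cancel_left, l1_smul, abs_of_nonneg ht0]
  exact mul_le_of_le_one_left (l1_nonneg _) ht1

namespace UtilityRegular

variable {S A : Type*} [Fintype S] [Fintype A] {F : SAVec S A → ℝ} {l L Linf : ℝ}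
  (hF : UtilityRegular F l L Linf) (μ ν : SAVec S A)
include hF

lemma exists_sub_eq_inner :
    ∃ z ∈ segment ℝ ν μ, F μ - F ν = inner ℝ (gradient F z) (μ - ν) := by
  obtain ⟨z, hz, h⟩ := domain_mvt (f := F) (s := Set.univ) (x := ν) (y := μ)
    (f' := fderiv ℝ F) (fun x _ => (hF.differentiable x).hasFDerivAt.hasFDerivWithinAt)
    convex_univ (Set.mem_univ _) (Set.mem_univ _)
  exact ⟨z, hz, by rw [h, inner_gradient_left]⟩

lemma abs_sub_le : |F μ - F ν| ≤ l * l1 (μ - ν) := by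
  obtain ⟨z, -, h⟩ := hF.exists_sub_eq_inner μ ν
  rw [h]
  exact abs_inner_le_mul_l1 (hF.grad_le z) _

lemma abs_sub_sub_inner_le (hLinf : 0 ≤ Linf) :
    |F μ - F ν - inner ℝ (gradient F ν) (μ - ν)| ≤ Linf * l1 (μ - ν) ^ 2 := by
  obtain ⟨z, hz, h⟩ := hF.exists_sub_eq_inner μ ν
  rw [h, ← inner_sub_left, sq, ← mul_assoc]
  refine abs_inner_le_mul_l1 (fun i => (hF.grad_lip_one z ν i).trans ?_) _
  exact mul_le_mul_of_nonneg_left (l1_sub_le_of_mem_segment hz) hLinf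

end UtilityRegular

end Utility

section Discounting

variable {γ : ℝ} (hγ0 : 0 ≤ γ) (hγ1 : γ < 1)
include hγ0 hγ1

lemma hasSum_pow_mul_add (c : ℝ) :
    HasSum (fun t : ℕ => γ ^ t * (t + 1 + c)) ((1 - γ)⁻¹ ^ 2 + c * (1 - γ)⁻¹) := by
  have hγ : 1 - γ ≠ 0 := by linarith
  have h_linear := hasSum_coe_mul_geometric_of_norm_lt_one (𝕜 := ℝ) (r := γ)
    (by rwa [Real.norm_eq_abs, abs_of_nonneg hγ0])
  have h_const := (hasSum_geometric_of_lt_one hγ0 hγ1).mul_left (1 + c)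
  have h_terms : (fun t : ℕ => γ ^ t * (t + 1 + c)) =
      fun t : ℕ => (t : ℝ) * γ ^ t + (1 + c) * γ ^ t := by
    funext t
    ring
  have h_sum : (1 - γ)⁻¹ ^ 2 + c * (1 - γ)⁻¹ = γ / (1 - γ) ^ 2 + (1 + c) * (1 - γ)⁻¹ := by
    field_simp
    ring
  rw [h_terms, h_sum]
  exact h_linear.add h_const

lemma sum_fin_pow_le (H : ℕ) : ∑ h : Fin H, γ ^ (h : ℕ) ≤ (1 - γ)⁻¹ := by
  rw [Fin.sum_univ_eq_sum_range (fun h => γ ^ h)]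
  exact sum_le_hasSum _ (fun _ _ => by positivity) (hasSum_geometric_of_lt_one hγ0 hγ1)

lemma sum_fin_pow_mul_add_one_le (H : ℕ) :
    ∑ h : Fin H, γ ^ (h : ℕ) * ((h : ℕ) + 1 : ℝ) ≤ (1 - γ)⁻¹ ^ 2 := by
  rw [Fin.sum_univ_eq_sum_range (fun h => γ ^ h * ((h : ℝ) + 1))]
  exact sum_le_hasSum _ (fun _ _ => by positivity) (by simpa using hasSum_pow_mul_add hγ0 hγ1 0)

lemma norm_sum_return_smul_le {E : Type*} [SeminormedAddCommGroup E] [NormedSpace ℝ E] {H : ℕ}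
    {r : Fin H → ℝ} {u : Fin H → E} {c B : ℝ} (hc : 0 ≤ c) (hB : 0 ≤ B) (hr : ∀ h, |r h| ≤ c)
    (hu : ∀ t, ‖u t‖ ≤ B) :
    ‖∑ t : Fin H, (∑ h ∈ Finset.Ici t, γ ^ (h : ℕ) * r h) • u t‖ ≤ c * B * (1 - γ)⁻¹ ^ 2 := by
  have h_swap : ∑ t : Fin H, (∑ h ∈ Finset.Ici t, γ ^ (h : ℕ) * r h) • u t =
      ∑ h : Fin H, (γ ^ (h : ℕ) * r h) • ∑ t ∈ Finset.Iic h, u t := by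
    simp only [Finset.sum_smul, Finset.smul_sum]
    exact Finset.sum_comm' (by simp)
  have h_term (h : Fin H) : ‖(γ ^ (h : ℕ) * r h) • ∑ t ∈ Finset.Iic h, u t‖ ≤
      c * B * (γ ^ (h : ℕ) * ((h : ℕ) + 1)) := by
    have h_sum : ‖∑ t ∈ Finset.Iic h, u t‖ ≤ ((h : ℕ) + 1) * B := by
      simpa using norm_sum_le_of_le (Finset.Iic h) fun t _ => hu t
    rw [norm_smul, norm_mul, norm_pow, Real.norm_of_nonneg hγ0, Real.norm_eq_abs]
    calc γ ^ (h : ℕ) * |r h| * ‖∑ t ∈ Finset.Iic h, u t‖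
        ≤ γ ^ (h : ℕ) * c * (((h : ℕ) + 1) * B) := by gcongr; exact hr h
      _ = c * B * (γ ^ (h : ℕ) * ((h : ℕ) + 1)) := by ring
  calc ‖∑ t : Fin H, (∑ h ∈ Finset.Ici t, γ ^ (h : ℕ) * r h) • u t‖
      ≤ ∑ h : Fin H, c * B * (γ ^ (h : ℕ) * ((h : ℕ) + 1)) :=
        h_swap ▸ norm_sum_le_of_le _ fun h _ => h_term h
    _ ≤ c * B * (1 - γ)⁻¹ ^ 2 := by
        rw [← Finset.mul_sum]
        gcongr
        exact sum_fin_pow_mul_add_one_le hγ0 hγ1 H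

end Discounting

lemma sum_abs_tsum_le {X : Type*} [Fintype X] {f : ℕ → X → ℝ} {b : ℕ → ℝ} {B : ℝ}
    (hb : HasSum b B) (h : ∀ t, ∑ x, |f t x| ≤ b t) : ∑ x, |∑' t, f t x| ≤ B := by
  have h_summable (x : X) : Summable fun t => |f t x| :=
    Summable.of_nonneg_of_le (fun t => abs_nonneg _)
      (fun t => (Finset.single_le_sum (f := fun x => |f t x|) (fun _ _ => abs_nonneg _)
        (Finset.mem_univ x)).trans (h t)) hb.summable
  calc ∑ x, |∑' t, f t x|
      ≤ ∑ x, ∑' t, |f t x| := Finset.sum_le_sum fun x _ => by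
        exact norm_tsum_le_tsum_norm (f := fun t => f t x) (h_summable x)
    _ = ∑' t, ∑ x, |f t x| := (Summable.tsum_finsetSum fun x _ => h_summable x).symm
    _ ≤ ∑' t, b t := (summable_sum fun x _ => h_summable x).tsum_le_tsum h hb.summable
    _ = B := hb.tsum_eq

section Occupancy

variable {S A : Type*} [DecidableEq S] [DecidableEq A] {γ : ℝ}

lemma occEst_succ (γ : ℝ) {H : ℕ} (τ : Traj S A (H + 1)) :
    occEst γ τ = occEst γ (Fin.init τ) + γ ^ H • EuclideanSpace.single (τ (Fin.last H)) 1 := by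
  rw [occEst, Fin.sum_univ_castSucc]
  rfl

variable [Fintype S] [Fintype A]

lemma inner_occEst (γ : ℝ) {H : ℕ} (r : SAVec S A) (τ : Traj S A H) :
    inner ℝ r (occEst γ τ) = ∑ h : Fin H, γ ^ (h : ℕ) * r (τ h) := by
  simp [occEst, inner_sum, inner_smul_right, EuclideanSpace.inner_single_right]

lemma l1_occEst_le (hγ0 : 0 ≤ γ) (hγ1 : γ < 1) {H : ℕ} (τ : Traj S A H) :
    l1 (occEst γ τ) ≤ (1 - γ)⁻¹ := by
  have h_single (x : S × A) : l1 (EuclideanSpace.single x (1 : ℝ)) = 1 := by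
    simp [l1, apply_ite abs]
  calc l1 (occEst γ τ)
      ≤ ∑ h : Fin H, l1 (γ ^ (h : ℕ) • EuclideanSpace.single (τ h) (1 : ℝ)) := l1_sum_le _ _
    _ = ∑ h : Fin H, γ ^ (h : ℕ) := by
        simp only [l1_smul, h_single, mul_one, abs_of_nonneg (pow_nonneg hγ0 _)]
    _ ≤ (1 - γ)⁻¹ := sum_fin_pow_le hγ0 hγ1 H

namespace MDP

variable (M : MDP S A) {π π' : S → A → ℝ} (hπ : IsPolicy π) (hπ' : IsPolicy π')

/-- The expectation of `occEst` over the trajectories of length `H`: the occupancy measure without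
the times `t ≥ H`. -/
def truncOcc (γ : ℝ) (π : S → A → ℝ) (H : ℕ) : SAVec S A :=
  ∑ τ, M.trajProb π H τ • occEst γ τ

lemma truncOcc_zero (γ : ℝ) (π : S → A → ℝ) : M.truncOcc γ π 0 = 0 := by
  simp [truncOcc, occEst]

include hπ

lemma saProb_nonneg (t : ℕ) (x : S × A) : 0 ≤ M.saProb π t x := by
  refine Finset.sum_nonneg fun τ _ => ?_
  split_ifs
  exacts [M.trajProb_nonneg _ hπ _, le_rfl]

lemma sum_saProb (t : ℕ) : ∑ x, M.saProb π t x = 1 := by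
  simp only [saProb]
  rw [Finset.sum_comm]
  simp [M.sum_trajProb _ hπ]

lemma sum_abs_saProb (t : ℕ) : ∑ x, |M.saProb π t x| = 1 := by
  simp only [abs_of_nonneg (M.saProb_nonneg hπ t _), M.sum_saProb hπ]

lemma saProb_le_one (t : ℕ) (x : S × A) : M.saProb π t x ≤ 1 :=
  (Finset.single_le_sum (fun y _ => M.saProb_nonneg hπ t y) (Finset.mem_univ x)).trans_eq
    (M.sum_saProb hπ t)

lemma truncOcc_apply (γ : ℝ) (H : ℕ) (x : S × A) :
    M.truncOcc γ π H x = ∑ t ∈ Finset.range H, γ ^ t * M.saProb π t x := by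
  induction H with
  | zero => simp [truncOcc_zero]
  | succ H ih =>
    have h_succ : M.truncOcc γ π (H + 1) = M.truncOcc γ π H +
        γ ^ H • ∑ τ : Traj S A (H + 1), M.trajProb π (H + 1) τ •
          EuclideanSpace.single (τ (Fin.last H)) (1 : ℝ) := by
      simp only [truncOcc, occEst_succ, smul_add, Finset.sum_add_distrib, Finset.smul_sum,
        smul_comm (γ ^ H), M.sum_trajProb_smul_init H hπ (occEst γ)]
    rw [Finset.sum_range_succ, ← ih, h_succ]
    simp [saProb, Finset.sum_apply, Pi.single_apply, eq_comm]

include hπ' in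
lemma sum_abs_saProb_sub_le {D : ℝ} (hD : ∀ s, ∑ a, |π' s a - π s a| ≤ D) (t : ℕ) :
    ∑ x, |M.saProb π' t x - M.saProb π t x| ≤ (t + 1) * D := by
  have h_apply (x : S × A) : |M.saProb π' t x - M.saProb π t x| ≤ ∑ τ : Traj S A (t + 1),
      if τ (Fin.last t) = x then |M.trajProb π' (t + 1) τ - M.trajProb π (t + 1) τ| else 0 := by
    rw [saProb, saProb, ← Finset.sum_sub_distrib]
    refine Finset.abs_sum_le_sum_abs _ _ |>.trans (Finset.sum_le_sum fun τ _ => ?_)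
    split_ifs <;> simp
  calc ∑ x, |M.saProb π' t x - M.saProb π t x|
      ≤ ∑ x, ∑ τ : Traj S A (t + 1), if τ (Fin.last t) = x then
          |M.trajProb π' (t + 1) τ - M.trajProb π (t + 1) τ| else 0 :=
        Finset.sum_le_sum fun x _ => h_apply x
    _ = ∑ τ, |M.trajProb π' (t + 1) τ - M.trajProb π (t + 1) τ| := by
        rw [Finset.sum_comm]
        simp
    _ ≤ (t + 1) * D := by exact_mod_cast M.sum_abs_trajProb_sub_le (t + 1) hπ hπ' hD

variable (hγ0 : 0 ≤ γ) (hγ1 : γ < 1)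
include hγ0 hγ1

lemma summable_saProb (x : S × A) : Summable fun t => γ ^ t * M.saProb π t x :=
  Summable.of_nonneg_of_le (fun t => mul_nonneg (pow_nonneg hγ0 t) (M.saProb_nonneg hπ t x))
    (fun t => mul_le_of_le_one_right (pow_nonneg hγ0 t) (M.saProb_le_one hπ t x))
    (summable_geometric_of_lt_one hγ0 hγ1)

lemma occupancy_sub_truncOcc_apply (H : ℕ) (x : S × A) :
    (M.occupancy γ π - M.truncOcc γ π H) x = ∑' t, γ ^ (t + H) * M.saProb π (t + H) x := by
  rw [PiLp.sub_apply, M.truncOcc_apply hπ, sub_eq_iff_eq_add']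
  exact ((M.summable_saProb hπ hγ0 hγ1 x).sum_add_tsum_nat_add H).symm

lemma l1_occupancy_sub_truncOcc_le (H : ℕ) :
    l1 (M.occupancy γ π - M.truncOcc γ π H) ≤ γ ^ H * (1 - γ)⁻¹ := by
  simp only [l1, M.occupancy_sub_truncOcc_apply hπ hγ0 hγ1]
  refine sum_abs_tsum_le ((hasSum_geometric_of_lt_one hγ0 hγ1).mul_left (γ ^ H)) fun t => ?_
  simp only [abs_mul, ← Finset.mul_sum, M.sum_abs_saProb hπ, mul_one]
  rw [abs_of_nonneg (by positivity), pow_add, mul_comm]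

lemma l1_occupancy_le : l1 (M.occupancy γ π) ≤ (1 - γ)⁻¹ := by
  simpa [M.truncOcc_zero] using M.l1_occupancy_sub_truncOcc_le hπ hγ0 hγ1 0

variable {D : ℝ} (hD : ∀ s, ∑ a, |π' s a - π s a| ≤ D)
include hπ' hD

lemma l1_occupancy_tail_sub_le (H : ℕ) :
    l1 ((M.occupancy γ π' - M.truncOcc γ π' H) - (M.occupancy γ π - M.truncOcc γ π H)) ≤
      γ ^ H * D * ((1 - γ)⁻¹ ^ 2 + H * (1 - γ)⁻¹) := by
  have h_summable {π : S → A → ℝ} (hπ : IsPolicy π) (x : S × A) :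
      Summable fun t => γ ^ (t + H) * M.saProb π (t + H) x :=
    (summable_nat_add_iff (f := fun t => γ ^ t * M.saProb π t x) H).2
      (M.summable_saProb hπ hγ0 hγ1 x)
  have h_apply (x : S × A) : ((M.occupancy γ π' - M.truncOcc γ π' H) -
      (M.occupancy γ π - M.truncOcc γ π H)) x =
        ∑' t, γ ^ (t + H) * (M.saProb π' (t + H) x - M.saProb π (t + H) x) := by
    rw [PiLp.sub_apply, M.occupancy_sub_truncOcc_apply hπ hγ0 hγ1,
      M.occupancy_sub_truncOcc_apply hπ' hγ0 hγ1,
      ← (h_summable hπ' x).tsum_sub (h_summable hπ x)]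
    simp only [mul_sub]
  simp only [l1, h_apply]
  refine sum_abs_tsum_le ((hasSum_pow_mul_add hγ0 hγ1 H).mul_left (γ ^ H * D)) fun t => ?_
  simp only [abs_mul, ← Finset.mul_sum, abs_of_nonneg (pow_nonneg hγ0 _)]
  calc γ ^ (t + H) * ∑ x, |M.saProb π' (t + H) x - M.saProb π (t + H) x|
      ≤ γ ^ (t + H) * (((t + H : ℕ) + 1) * D) := by
        gcongr
        exact M.sum_abs_saProb_sub_le hπ hπ' hD (t + H)
    _ = γ ^ H * D * (γ ^ t * (t + 1 + H)) := by
        push_cast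
        ring

lemma l1_occupancy_sub_le :
    l1 (M.occupancy γ π' - M.occupancy γ π) ≤ D * (1 - γ)⁻¹ ^ 2 := by
  simpa [M.truncOcc_zero] using M.l1_occupancy_tail_sub_le hπ hπ' hγ0 hγ1 hD 0

lemma l1_truncOcc_sub_le (H : ℕ) :
    l1 (M.truncOcc γ π' H - M.truncOcc γ π H) ≤ D * (1 - γ)⁻¹ ^ 2 := by
  have h_saProb := M.sum_abs_saProb_sub_le hπ hπ' hD
  have h_series : HasSum (fun t : ℕ => D * (γ ^ t * (t + 1))) (D * (1 - γ)⁻¹ ^ 2) := by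
    simpa using (hasSum_pow_mul_add hγ0 hγ1 0).mul_left D
  have h_nonneg (t : ℕ) : 0 ≤ D * (γ ^ t * (t + 1)) := by
    have := (Finset.sum_nonneg fun _ _ => abs_nonneg _).trans (h_saProb t)
    nlinarith [pow_nonneg hγ0 t]
  calc l1 (M.truncOcc γ π' H - M.truncOcc γ π H)
      = ∑ x, |∑ t ∈ Finset.range H, γ ^ t * (M.saProb π' t x - M.saProb π t x)| := by
        simp only [l1, PiLp.sub_apply, M.truncOcc_apply hπ, M.truncOcc_apply hπ', mul_sub,
          Finset.sum_sub_distrib]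
    _ ≤ ∑ x, ∑ t ∈ Finset.range H, γ ^ t * |M.saProb π' t x - M.saProb π t x| := by
        refine Finset.sum_le_sum fun x _ => (Finset.abs_sum_le_sum_abs _ _).trans_eq ?_
        simp only [abs_mul, abs_of_nonneg (pow_nonneg hγ0 _)]
    _ ≤ ∑ t ∈ Finset.range H, D * (γ ^ t * (t + 1)) := by
        rw [Finset.sum_comm]
        refine Finset.sum_le_sum fun t _ => ?_
        rw [← Finset.mul_sum]
        exact (mul_le_mul_of_nonneg_left (h_saProb t) (pow_nonneg hγ0 t)).trans_eq (by ring)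
    _ ≤ D * (1 - γ)⁻¹ ^ 2 := sum_le_hasSum _ (fun t _ => h_nonneg t) h_series

end MDP

end Occupancy

section PolicyGradient

variable {S A : Type*} [Fintype A] {d H : ℕ} {ψ : S → A → Param d → ℝ}
  {γ l L c : ℝ}

lemma pgEst_sub_pgEst (γ : ℝ) (ψ : S → A → Param d → ℝ) (τ : Traj S A H) (θ θ' : Param d)
    (r r' : SAVec S A) :
    pgEst γ ψ τ θ' r' - pgEst γ ψ τ θ r =
      ∑ t : Fin H, (∑ h ∈ Finset.Ici t, γ ^ (h : ℕ) * (r' - r) (τ h)) • score ψ θ' (τ t) +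
        ∑ t : Fin H, (∑ h ∈ Finset.Ici t, γ ^ (h : ℕ) * r (τ h)) •
          (score ψ θ' (τ t) - score ψ θ (τ t)) := by
  simp only [pgEst, score, PiLp.sub_apply, mul_sub, Finset.sum_sub_distrib, sub_smul, smul_sub,
    sub_add_sub_cancel]

namespace PolicyRegular

variable [Nonempty A] (hψ : PolicyRegular ψ l L) (hγ0 : 0 ≤ γ) (hγ1 : γ < 1) (τ : Traj S A H)
  {r r' : SAVec S A} (hc : 0 ≤ c) (hr : ∀ i, |r i| ≤ c)
include hψ hγ0 hγ1 hc hr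

lemma norm_pgEst_le (hl : 0 ≤ l) (θ : Param d) :
    ‖pgEst γ ψ τ θ r‖ ≤ c * (2 * l) * (1 - γ)⁻¹ ^ 2 :=
  norm_sum_return_smul_le hγ0 hγ1 hc (by positivity) (fun h => hr (τ h))
    fun t => hψ.norm_score_le θ (τ t)

lemma norm_pgEst_sub_le (hl : 0 ≤ l) (hL : 0 ≤ L) {δ : ℝ} (hδ : 0 ≤ δ)
    (hr' : ∀ i, |r' i - r i| ≤ δ) (θ θ' : Param d) :
    ‖pgEst γ ψ τ θ' r' - pgEst γ ψ τ θ r‖ ≤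
      (2 * l * δ + 2 * (L + l ^ 2) * c * ‖θ' - θ‖) * (1 - γ)⁻¹ ^ 2 := by
  have h_reward := norm_sum_return_smul_le hγ0 hγ1 hδ (by positivity) (fun h => hr' (τ h))
    fun t => hψ.norm_score_le θ' (τ t)
  have h_score := norm_sum_return_smul_le hγ0 hγ1 hc (by positivity) (fun h => hr (τ h))
    fun t => hψ.norm_score_sub_le θ θ' (τ t)
  rw [pgEst_sub_pgEst]
  exact (norm_add_le_of_le h_reward h_score).trans_eq (by ring)

end PolicyRegular

end PolicyGradient

section Expansion

variable {S A : Type*} [Fintype S] [Fintype A] [Nonempty A] {d : ℕ} {ψ : S → A → Param d → ℝ}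
  {γ l L c : ℝ}

namespace MDP

variable (M : MDP S A)

omit [Fintype A] [Nonempty A] in
include M in
lemma nonempty_state : Nonempty S := by
  by_contra h
  rw [not_nonempty_iff] at h
  simpa using M.ρ_sum

/-- The expectation of the truncated policy gradient estimate. -/
def meanGrad (γ : ℝ) (ψ : S → A → Param d → ℝ) (H : ℕ) (θ : Param d) (r : SAVec S A) : Param d :=
  ∑ τ : Traj S A H, M.trajProb (softmax ψ θ) H τ • pgEst γ ψ τ θ r

variable [DecidableEq S] [DecidableEq A] (hψ : PolicyRegular ψ l L) {H : ℕ} {θ θ' : Param d}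
  {r : SAVec S A}
include hψ

lemma meanGrad_eq : M.meanGrad γ ψ H θ r = ∑ τ : Traj S A H, M.trajProb (softmax ψ θ) H τ •
    (inner ℝ r (occEst γ τ) • ∑ t, score ψ θ (τ t)) := by
  simp only [inner_occEst]
  exact (M.sum_trajProb_smul_return_smul_score H (isPolicy_softmax ψ θ)
    (fun s => sum_softmax_smul_score θ s hψ.differentiable) (fun h x => γ ^ h * r x)).symm

lemma inner_truncOcc_sub_sub_inner_meanGrad :
    inner ℝ r (M.truncOcc γ (softmax ψ θ') H - M.truncOcc γ (softmax ψ θ) H) -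
        inner ℝ (M.meanGrad γ ψ H θ r) (θ' - θ) =
      ∑ τ : Traj S A H, M.trajProb (softmax ψ θ) H τ * (inner ℝ r (occEst γ τ) *
        (isWeight ψ τ θ' θ - 1 - inner ℝ (∑ t, score ψ θ (τ t)) (θ' - θ))) := by
  rw [M.meanGrad_eq hψ, truncOcc, truncOcc, inner_sub_right, inner_sum, inner_sum, sum_inner,
    ← Finset.sum_sub_distrib, ← Finset.sum_sub_distrib]
  refine Finset.sum_congr rfl fun τ _ => ?_
  rw [inner_smul_right, inner_smul_right, real_inner_smul_left, real_inner_smul_left,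
    ← M.trajProb_mul_isWeight ψ τ θ' θ]
  ring

variable (hγ0 : 0 ≤ γ) (hγ1 : γ < 1) (h : 2 * H * l * ‖θ' - θ‖ ≤ 1) (hr : ∀ i, |r i| ≤ c)
include hγ0 hγ1 h hr

lemma abs_inner_truncOcc_sub_sub_inner_meanGrad_le :
    |inner ℝ r (M.truncOcc γ (softmax ψ θ') H - M.truncOcc γ (softmax ψ θ) H) -
        inner ℝ (M.meanGrad γ ψ H θ r) (θ' - θ)| ≤
      c * (1 - γ)⁻¹ * ((2 * H * (L + l ^ 2) + (2 * H * l) ^ 2) * ‖θ' - θ‖ ^ 2) := by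
  obtain ⟨s⟩ := M.nonempty_state
  have hc : 0 ≤ c := (abs_nonneg _).trans (hr (s, Classical.arbitrary A))
  have h_inner (τ : Traj S A H) : |inner ℝ r (occEst γ τ)| ≤ c * (1 - γ)⁻¹ :=
    (abs_inner_le_mul_l1 hr _).trans (mul_le_mul_of_nonneg_left (l1_occEst_le hγ0 hγ1 τ) hc)
  have h_term (τ : Traj S A H) : ‖inner ℝ r (occEst γ τ) *
        (isWeight ψ τ θ' θ - 1 - inner ℝ (∑ t, score ψ θ (τ t)) (θ' - θ))‖ ≤
      c * (1 - γ)⁻¹ * ((2 * H * (L + l ^ 2) + (2 * H * l) ^ 2) * ‖θ' - θ‖ ^ 2) := by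
    rw [norm_mul]
    exact mul_le_mul (h_inner τ) (hψ.abs_isWeight_sub_one_sub_inner_le τ h) (norm_nonneg _)
      ((abs_nonneg _).trans (h_inner τ))
  rw [M.inner_truncOcc_sub_sub_inner_meanGrad hψ, ← Real.norm_eq_abs]
  refine (norm_sum_smul_le h_term).trans_eq ?_
  simp only [abs_of_nonneg (M.trajProb_nonneg H (isPolicy_softmax ψ θ) _),
    M.sum_trajProb H (isPolicy_softmax ψ θ), one_mul]

lemma abs_utility_sub_sub_inner_meanGrad_le {F : SAVec S A → ℝ} {lF LF Linf σ : ℝ}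
    (hF : UtilityRegular F lF LF Linf) (hLinf : 0 ≤ Linf)
    (hσ : ∀ i, |gradient F (occ M γ ψ θ) i - r i| ≤ σ) :
    |F (occ M γ ψ θ') - F (occ M γ ψ θ) - inner ℝ (M.meanGrad γ ψ H θ r) (θ' - θ)| ≤
      2 * l * (lF * γ ^ H * ((1 - γ)⁻¹ ^ 2 + H * (1 - γ)⁻¹) + σ * (1 - γ)⁻¹ ^ 2) * ‖θ' - θ‖ +
        (Linf * (2 * l * (1 - γ)⁻¹ ^ 2) ^ 2 +
          c * (1 - γ)⁻¹ * (2 * H * (L + l ^ 2) + (2 * H * l) ^ 2)) * ‖θ' - θ‖ ^ 2 := by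
  obtain ⟨s⟩ := M.nonempty_state
  let i : S × A := (s, Classical.arbitrary A)
  have hσ0 : 0 ≤ σ := (abs_nonneg _).trans (hσ i)
  have hlF : 0 ≤ lF := (abs_nonneg _).trans (hF.grad_le 0 i)
  have hπ := isPolicy_softmax ψ θ
  have hπ' := isPolicy_softmax ψ θ'
  have hD := hψ.sum_abs_softmax_sub_le θ θ'
  have h_smooth := (hF.abs_sub_sub_inner_le (occ M γ ψ θ') (occ M γ ψ θ) hLinf).trans
    (mul_le_mul_of_nonneg_left (pow_le_pow_left₀ (l1_nonneg _)
      (M.l1_occupancy_sub_le hπ hπ' hγ0 hγ1 hD) 2) hLinf)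
  have h_tail := (abs_inner_le_mul_l1 (hF.grad_le (occ M γ ψ θ)) _).trans
    (mul_le_mul_of_nonneg_left (M.l1_occupancy_tail_sub_le hπ hπ' hγ0 hγ1 hD H) hlF)
  have h_reward := (abs_inner_le_mul_l1 (r := gradient F (occ M γ ψ θ) - r) hσ _).trans
    (mul_le_mul_of_nonneg_left (M.l1_truncOcc_sub_le hπ hπ' hγ0 hγ1 hD H) hσ0)
  have h_trunc := M.abs_inner_truncOcc_sub_sub_inner_meanGrad_le hψ hγ0 hγ1 h hr
  rw [abs_le] at *
  simp only [occ, inner_sub_left, inner_sub_right] at *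
  constructor <;> linarith

end MDP

end Expansion

section Variance

/-- The error is `β (x - m)` plus the centred `Y`, so its cross term vanishes in the mean. Here `m`
and `m'` are the targets estimated before and after the update. -/
lemma sum_mul_norm_recursive_sub_sq_le {ι E : Type*} [Fintype ι] [NormedAddCommGroup E]
    [InnerProductSpace ℝ E] {p : ι → ℝ} (hp : ∀ i, 0 ≤ p i) (hp1 : ∑ i, p i = 1) {Y : ι → E}
    {b β : ℝ} (hY : ∀ i, ‖Y i‖ ≤ b) {m m' : E} (hm : ∑ i, p i • Y i = m' - β • m) (x : E) :
    ∑ i, p i * ‖β • x + Y i - m'‖ ^ 2 ≤ (β * ‖x - m‖) ^ 2 + b ^ 2 := by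
  set c := β • x - m'
  have h_expand i : p i * ‖β • x + Y i - m'‖ ^ 2 =
      p i * ‖c‖ ^ 2 + 2 * inner ℝ c (p i • Y i) + p i * ‖Y i‖ ^ 2 := by
    rw [add_sub_right_comm, norm_add_sq_real, inner_smul_right]
    ring
  have h_second : ∑ i, p i * ‖Y i‖ ^ 2 ≤ b ^ 2 := by
    calc _ ≤ ∑ i, p i * b ^ 2 := Finset.sum_le_sum fun i _ =>
          mul_le_mul_of_nonneg_left (pow_le_pow_left₀ (norm_nonneg _) (hY i) 2) (hp i)
      _ = b ^ 2 := by rw [← Finset.sum_mul, hp1, one_mul]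
  have h_bias : (β * ‖x - m‖) ^ 2 = ‖c + (m' - β • m)‖ ^ 2 := by
    rw [show c + (m' - β • m) = β • (x - m) by module, norm_smul, mul_pow, mul_pow,
      Real.norm_eq_abs, sq_abs]
  simp only [h_expand, Finset.sum_add_distrib]
  rw [← Finset.sum_mul, hp1, one_mul, ← Finset.mul_sum, ← inner_sum, hm, h_bias, norm_add_sq_real]
  linarith [sq_nonneg ‖m' - β • m‖]

end Variance

section NormalizedStep

variable {d : ℕ} {α : ℝ}

lemma norm_normStep_sub_le (hα : 0 ≤ α) (θ v : Param d) : ‖normStep α θ v - θ‖ ≤ α := by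
  rw [normStep, add_sub_cancel_left, norm_smul, norm_div, norm_norm, Real.norm_of_nonneg hα]
  rw [div_mul_eq_mul_div, mul_div_assoc]
  exact mul_le_of_le_one_right hα (div_self_le_one _)

lemma inner_normStep_sub (α : ℝ) (θ v : Param d) :
    inner ℝ v (normStep α θ v - θ) = α * ‖v‖ := by
  rw [normStep, add_sub_cancel_left, inner_smul_right, real_inner_self_eq_norm_sq]
  rcases eq_or_ne ‖v‖ 0 with h | h
  · simp [h]
  · field_simp

end NormalizedStep

section Momentum

lemma etaSeq_pos (t : ℕ) : 0 < etaSeq t := by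
  rw [etaSeq]; positivity

lemma one_sub_etaSeq_succ (t : ℕ) : 1 - etaSeq (t + 1) = t / (t + 2) := by
  rw [etaSeq]
  push_cast
  field_simp
  ring

lemma one_sub_etaSeq_succ_nonneg (t : ℕ) : 0 ≤ 1 - etaSeq (t + 1) := by
  rw [one_sub_etaSeq_succ]; positivity

lemma etaSeq_le_two_mul_succ {n : ℕ} (hn : 1 ≤ n) : etaSeq n ≤ 2 * etaSeq (n + 1) := by
  have : (1 : ℝ) ≤ n := by exact_mod_cast hn
  simp only [etaSeq]
  push_cast
  rw [mul_div_assoc', div_le_div_iff₀ (by positivity) (by positivity)]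
  linarith

lemma etaSeq_succ_mul_le (n : ℕ) : etaSeq (n + 1) * n ≤ 2 := by
  simp only [etaSeq]
  push_cast
  rw [div_mul_eq_mul_div, div_le_iff₀ (by positivity)]
  linarith

/-- The momentum `η_t = 2 / (t + 1)` averages the noise `a η_t` out, while the noise `c`
accumulates linearly. -/
lemma le_of_momentum_recursion {V : ℕ → ℝ} {a c : ℝ}
    (hV : ∀ t, V (t + 1) ≤ (1 - etaSeq (t + 1)) ^ 2 * V t + (a * etaSeq (t + 1) + c) ^ 2)
    {t : ℕ} (ht : 1 ≤ t) : V t ≤ 8 * a ^ 2 / (t + 1) + 2 * c ^ 2 * t := by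
  induction t, ht using Nat.le_induction with
  | base =>
    have h_first := hV 0
    norm_num [etaSeq] at h_first ⊢
    nlinarith [sq_nonneg (a - c), sq_nonneg a]
  | succ t _ ih =>
    have h_step := hV t
    have h_eta : etaSeq (t + 1) = 2 / ((t : ℝ) + 2) := by rw [etaSeq]; push_cast; ring
    rw [one_sub_etaSeq_succ, h_eta] at h_step
    set x : ℝ := (t : ℝ)
    have hx : 0 ≤ x := Nat.cast_nonneg t
    have h_ratio : (x / (x + 2)) ^ 2 ≤ 1 :=
      pow_le_one₀ (by positivity) ((div_le_one (by positivity)).2 (by linarith))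
    have h_square : (a * (2 / (x + 2)) + c) ^ 2 ≤ 8 * a ^ 2 / (x + 2) ^ 2 + 2 * c ^ 2 := by
      refine add_sq_le.trans (le_of_eq ?_)
      field_simp
      ring
    have h_average : (x / (x + 2)) ^ 2 * (8 * a ^ 2 / (x + 1)) + 8 * a ^ 2 / (x + 2) ^ 2 ≤
        8 * a ^ 2 / (x + 1 + 1) := by
      have h : (x / (x + 2)) ^ 2 / (x + 1) + 1 / (x + 2) ^ 2 ≤ 1 / (x + 1 + 1) := by
        rw [div_pow, div_div, div_add_div _ _ (by positivity) (by positivity),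
          div_le_div_iff₀ (by positivity) (by positivity)]
        nlinarith [pow_pos (by linarith : 0 < x + 2) 3]
      calc _ = 8 * a ^ 2 * ((x / (x + 2)) ^ 2 / (x + 1) + 1 / (x + 2) ^ 2) := by ring
        _ ≤ 8 * a ^ 2 * (1 / (x + 1 + 1)) := by gcongr
        _ = _ := by ring
    push_cast
    calc V (t + 1) ≤ (x / (x + 2)) ^ 2 * (8 * a ^ 2 / (x + 1) + 2 * c ^ 2 * x) +
          (8 * a ^ 2 / (x + 2) ^ 2 + 2 * c ^ 2) := h_step.trans (by gcongr)
      _ = (x / (x + 2)) ^ 2 * (8 * a ^ 2 / (x + 1)) + 8 * a ^ 2 / (x + 2) ^ 2 +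
          ((x / (x + 2)) ^ 2 * (2 * c ^ 2 * x) + 2 * c ^ 2) := by ring
      _ ≤ 8 * a ^ 2 / (x + 1 + 1) + (1 * (2 * c ^ 2 * x) + 2 * c ^ 2) := by gcongr
      _ = _ := by ring

lemma le_sq_of_momentum_recursion {V : ℕ → ℝ} {a c : ℝ} (ha : 0 ≤ a) (hc : 0 ≤ c)
    (hV : ∀ t, V (t + 1) ≤ (1 - etaSeq (t + 1)) ^ 2 * V t + (a * etaSeq (t + 1) + c) ^ 2)
    {t T : ℕ} (ht : 1 ≤ t) (htT : t ≤ T) (hTt : T + 1 ≤ 2 * (t + 1)) :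
    V t ≤ (4 * a / √(T + 1) + 2 * c * √(T + 1)) ^ 2 := by
  have htT' : (t : ℝ) ≤ T := by exact_mod_cast htT
  have hTt' : ((T : ℝ) + 1) / 2 ≤ t + 1 := by
    have : (T : ℝ) + 1 ≤ 2 * (t + 1) := by exact_mod_cast hTt
    linarith
  have h_sqrt : √((T : ℝ) + 1) ^ 2 = T + 1 := Real.sq_sqrt (by positivity)
  calc V t ≤ 8 * a ^ 2 / (t + 1) + 2 * c ^ 2 * t := le_of_momentum_recursion hV ht
    _ ≤ 8 * a ^ 2 / (((T : ℝ) + 1) / 2) + 4 * c ^ 2 * (T + 1) := by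
      gcongr
      · norm_num
      · linarith
    _ = (4 * a / √(T + 1)) ^ 2 + (2 * c * √(T + 1)) ^ 2 := by
      rw [div_pow, mul_pow (2 * c), h_sqrt]
      field_simp
      ring
    _ ≤ (4 * a / √(T + 1) + 2 * c * √(T + 1)) ^ 2 := by
      have : 0 ≤ 4 * a / √((T : ℝ) + 1) * (2 * c * √(T + 1)) := by positivity
      linarith [add_sq (4 * a / √((T : ℝ) + 1)) (2 * c * √(T + 1))]

end Momentum

/-- The regime in which the algorithm is analysed: one number `N` dominates the effective horizon
`1 / (1 - γ)`, the horizon `H` and all regularity constants, and steps of length `α` are so short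
that importance weights between consecutive policies stay near one. With `N` of order `log T`
all bounds are powers of `N`, whose exponents do not matter. -/
structure StepRegime {S A : Type*} [Fintype S] [Fintype A] {d : ℕ} (γ : ℝ)
    (ψ : S → A → Param d → ℝ) (F : SAVec S A → ℝ) (H : ℕ) (N α : ℝ) : Prop where
  discount_nonneg : 0 ≤ γ
  discount_lt_one : γ < 1
  one_le : 1 ≤ N
  inv_le : (1 - γ)⁻¹ ≤ N
  horizon_le : H ≤ N
  policy : PolicyRegular ψ N N
  utility : UtilityRegular F N N N
  step_nonneg : 0 ≤ α
  step_le : 2 * N ^ 2 * α ≤ 1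

/-- Bounds on the variables of the algorithm that hold along every run after iteration `n`. -/
structure State.Bounded {S A : Type*} [Fintype S] [Fintype A] {d : ℕ} (F : SAVec S A → ℝ)
    (N α : ℝ) (n : ℕ) (s : State S A d) : Prop where
  dist_le : ‖s.θ - s.θprev‖ ≤ α
  r_eq : s.r = gradient F s.lam
  rprev_le : ∀ i, |s.rprev i| ≤ N
  lam_le : ‖s.lam‖ ≤ N + 4 * N ^ 3 * α * n
  r_sub_le : 1 ≤ n → ∀ i, |s.r i - s.rprev i| ≤ N * (2 * N * etaSeq n + 12 * N ^ 3 * α)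

section Increments

variable {S A : Type*} {d H : ℕ}

section Direction

variable [Fintype A]

/-- The part of the new direction that depends on the trajectory. -/
def dirIncr (γ : ℝ) (ψ : S → A → Param d → ℝ) (η : ℝ) (s : State S A d) (τ : Traj S A H) :
    Param d :=
  pgEst γ ψ τ s.θ s.r - (1 - η) • isWeight ψ τ s.θprev s.θ • pgEst γ ψ τ s.θprev s.rprev

lemma dirIncr_eq (γ : ℝ) (ψ : S → A → Param d → ℝ) (η : ℝ) (s : State S A d) (τ : Traj S A H) :
    dirIncr γ ψ η s τ = η • pgEst γ ψ τ s.θ s.r +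
      (1 - η) • (pgEst γ ψ τ s.θ s.r - pgEst γ ψ τ s.θprev s.rprev) +
      ((1 - η) * (1 - isWeight ψ τ s.θprev s.θ)) • pgEst γ ψ τ s.θprev s.rprev := by
  simp only [dirIncr]
  module

lemma sum_trajProb_smul_dirIncr [Fintype S] [Nonempty A] (M : MDP S A) (γ : ℝ)
    (ψ : S → A → Param d → ℝ) (s : State S A d) (η : ℝ) :
    ∑ τ : Traj S A H, M.trajProb (softmax ψ s.θ) H τ • dirIncr γ ψ η s τ =
      M.meanGrad γ ψ H s.θ s.r - (1 - η) • M.meanGrad γ ψ H s.θprev s.rprev := by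
  simp only [dirIncr, smul_sub, Finset.sum_sub_distrib, MDP.meanGrad, Finset.smul_sum]
  congr 1
  refine Finset.sum_congr rfl fun τ _ => ?_
  rw [← M.trajProb_mul_isWeight ψ τ s.θprev s.θ]
  module

end Direction

variable [DecidableEq S] [DecidableEq A]

/-- The part of the new occupancy estimate that depends on the trajectory. -/
def lamIncr [Fintype A] (γ : ℝ) (ψ : S → A → Param d → ℝ) (η : ℝ) (s : State S A d)
    (τ : Traj S A H) : SAVec S A :=
  occEst γ τ - (1 - η) • isWeight ψ τ s.θprev s.θ • occEst γ τ

variable [Fintype S] [Fintype A] {γ : ℝ} {ψ : S → A → Param d → ℝ} {F : SAVec S A → ℝ} {n : ℕ}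
  {s : State S A d}

lemma sum_trajProb_smul_lamIncr [Nonempty A] (M : MDP S A) (η : ℝ) :
    ∑ τ : Traj S A H, M.trajProb (softmax ψ s.θ) H τ • lamIncr γ ψ η s τ =
      M.truncOcc γ (softmax ψ s.θ) H - (1 - η) • M.truncOcc γ (softmax ψ s.θprev) H := by
  simp only [lamIncr, smul_sub, Finset.sum_sub_distrib, MDP.truncOcc, Finset.smul_sum]
  congr 1
  refine Finset.sum_congr rfl fun τ _ => ?_
  rw [← M.trajProb_mul_isWeight ψ τ s.θprev s.θ]
  module

lemma step_succ_lam (η α : ℕ → ℝ) (τ : Traj S A H) :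
    (step γ ψ F η α (n + 1) s τ).lam =
      (1 - η (n + 1)) • s.lam + lamIncr γ ψ (η (n + 1)) s τ := by
  simp only [step, lamIncr]
  module

lemma step_succ_dir (η α : ℕ → ℝ) (τ : Traj S A H) :
    (step γ ψ F η α (n + 1) s τ).dir =
      (1 - η (n + 1)) • s.dir + dirIncr γ ψ (η (n + 1)) s τ := by
  simp only [step, dirIncr]
  module

end Increments

namespace StepRegime

variable {S A : Type*} [Fintype S] [Fintype A] {d : ℕ} {ψ : S → A → Param d → ℝ}
  {F : SAVec S A → ℝ} {γ N α : ℝ} {H n : ℕ} {s : State S A d} (h : StepRegime γ ψ F H N α)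
include h

lemma scale_pos : 0 < N := zero_lt_one.trans_le h.one_le

lemma abs_r_le (hs : s.Bounded F N α n) (i : S × A) : |s.r i| ≤ N :=
  hs.r_eq ▸ h.utility.grad_le _ i

lemma norm_occEst_le [DecidableEq S] [DecidableEq A] (τ : Traj S A H) : ‖occEst γ τ‖ ≤ N :=
  (norm_le_l1 _).trans
    ((l1_occEst_le h.discount_nonneg h.discount_lt_one τ).trans h.inv_le)

variable [Nonempty A]

lemma norm_pgEst_le (τ : Traj S A H) {r : SAVec S A} (hr : ∀ i, |r i| ≤ N) (θ : Param d) :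
    ‖pgEst γ ψ τ θ r‖ ≤ 2 * N ^ 4 := by
  have hN := h.scale_pos
  have hinv : 0 ≤ (1 - γ)⁻¹ := inv_nonneg.2 (sub_nonneg.2 h.discount_lt_one.le)
  calc _ ≤ N * (2 * N) * (1 - γ)⁻¹ ^ 2 :=
        h.policy.norm_pgEst_le h.discount_nonneg h.discount_lt_one τ hN.le hr hN.le θ
    _ ≤ N * (2 * N) * N ^ 2 := by gcongr; exact h.inv_le
    _ = 2 * N ^ 4 := by ring

lemma norm_pgEst_sub_le (τ : Traj S A H) {r r' : SAVec S A} (hr : ∀ i, |r i| ≤ N) {δ : ℝ}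
    (hδ : 0 ≤ δ) (hr' : ∀ i, |r' i - r i| ≤ δ) (θ θ' : Param d) :
    ‖pgEst γ ψ τ θ' r' - pgEst γ ψ τ θ r‖ ≤ 2 * N ^ 3 * δ + 4 * N ^ 5 * ‖θ' - θ‖ := by
  have hN := h.scale_pos
  have hinv : 0 ≤ (1 - γ)⁻¹ := inv_nonneg.2 (sub_nonneg.2 h.discount_lt_one.le)
  have h_pow : N ≤ N ^ 2 := le_self_pow₀ h.one_le two_ne_zero
  calc _ ≤ (2 * N * δ + 2 * (N + N ^ 2) * N * ‖θ' - θ‖) * (1 - γ)⁻¹ ^ 2 :=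
        h.policy.norm_pgEst_sub_le h.discount_nonneg h.discount_lt_one τ hN.le hr hN.le hN.le hδ
          hr' θ θ'
    _ ≤ (2 * N * δ + 2 * (N ^ 2 + N ^ 2) * N * ‖θ' - θ‖) * N ^ 2 := by gcongr; exact h.inv_le
    _ = _ := by ring

lemma abs_one_sub_isWeight_le (hs : s.Bounded F N α n) (τ : Traj S A H) :
    |1 - isWeight ψ τ s.θprev s.θ| ≤ 4 * N ^ 2 * α := by
  have hN := h.scale_pos
  have hdist : ‖s.θprev - s.θ‖ ≤ α := norm_sub_rev s.θ s.θprev ▸ hs.dist_le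
  have h_near : H * N * ‖s.θprev - s.θ‖ ≤ N * N * α := by gcongr; exact h.horizon_le
  rw [abs_sub_comm]
  refine (h.policy.abs_isWeight_sub_one_le τ ?_).trans ?_
  · linarith [h.step_le]
  · linarith

lemma norm_lamIncr_le [DecidableEq S] [DecidableEq A] (hs : s.Bounded F N α n) {η : ℝ}
    (hη0 : 0 ≤ η) (hη1 : 0 ≤ 1 - η) (τ : Traj S A H) :
    ‖lamIncr γ ψ η s τ‖ ≤ N * η + 4 * N ^ 3 * α := by
  have hw := h.abs_one_sub_isWeight_le hs τ
  set w := isWeight ψ τ s.θprev s.θ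
  have h_factor : lamIncr γ ψ η s τ = (η + (1 - η) * (1 - w)) • occEst γ τ := by
    simp only [lamIncr]
    module
  have h_coeff : |η + (1 - η) * (1 - w)| ≤ η + 4 * N ^ 2 * α := by
    refine (abs_add_le _ _).trans ?_
    rw [abs_of_nonneg hη0, abs_mul, abs_of_nonneg hη1]
    linarith [mul_le_of_le_one_left (abs_nonneg (1 - w)) (by linarith : 1 - η ≤ 1)]
  rw [h_factor, norm_smul, Real.norm_eq_abs]
  refine (mul_le_mul h_coeff (h.norm_occEst_le τ) (norm_nonneg _)
    ((abs_nonneg _).trans h_coeff)).trans (le_of_eq ?_)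
  ring

/-- At iteration `1` the momentum is `η = 1`, so the unknown reward difference `r_0 - r_{-1}` drops
out of the increment. -/
lemma norm_dirIncr_le (hs : s.Bounded F N α n) (τ : Traj S A H) :
    ‖dirIncr γ ψ (etaSeq (n + 1)) s τ‖ ≤ 10 * N ^ 5 * etaSeq (n + 1) + 36 * N ^ 7 * α := by
  have hN := h.scale_pos
  have hα := h.step_nonneg
  have hη0 := (etaSeq_pos (n + 1)).le
  have hη1 := one_sub_etaSeq_succ_nonneg n
  have hg := h.norm_pgEst_le τ (h.abs_r_le hs) s.θ
  have hg' := h.norm_pgEst_le τ hs.rprev_le s.θprev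
  have hw := h.abs_one_sub_isWeight_le hs τ
  have h_drift : (1 - etaSeq (n + 1)) * ‖pgEst γ ψ τ s.θ s.r - pgEst γ ψ τ s.θprev s.rprev‖ ≤
      8 * N ^ 5 * etaSeq (n + 1) + 28 * N ^ 7 * α := by
    rcases Nat.eq_zero_or_pos n with rfl | hn
    · rw [one_sub_etaSeq_succ, Nat.cast_zero, zero_div, zero_mul]
      positivity
    have h_reward i : |s.r i - s.rprev i| ≤ N * (4 * N * etaSeq (n + 1) + 12 * N ^ 3 * α) :=
      (hs.r_sub_le hn i).trans (by
        rw [show 4 * N * etaSeq (n + 1) = 2 * N * (2 * etaSeq (n + 1)) by ring]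
        gcongr
        exact etaSeq_le_two_mul_succ hn)
    calc _ ≤ 1 * (2 * N ^ 3 * (N * (4 * N * etaSeq (n + 1) + 12 * N ^ 3 * α)) +
          4 * N ^ 5 * ‖s.θ - s.θprev‖) := by
          gcongr
          · linarith
          · exact h.norm_pgEst_sub_le τ hs.rprev_le (by positivity) h_reward s.θprev s.θ
      _ ≤ 1 * (2 * N ^ 3 * (N * (4 * N * etaSeq (n + 1) + 12 * N ^ 3 * α)) + 4 * N ^ 7 * α) := by
          gcongr
          · exact h.one_le
          · norm_num
          · exact hs.dist_le
      _ = _ := by ring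
  rw [dirIncr_eq]
  refine (norm_add₃_le).trans ?_
  simp only [norm_smul, norm_mul, Real.norm_eq_abs, abs_of_nonneg hη0, abs_of_nonneg hη1]
  calc _ ≤ etaSeq (n + 1) * (2 * N ^ 5) + (8 * N ^ 5 * etaSeq (n + 1) + 28 * N ^ 7 * α) +
        1 * (4 * N ^ 2 * α) * (2 * N ^ 5) := by
        have h_pow : N ^ 4 ≤ N ^ 5 := pow_le_pow_right₀ h.one_le (by norm_num)
        gcongr
        · linarith
        · linarith
        · linarith
    _ = _ := by ring

variable [DecidableEq S] [DecidableEq A]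

omit [Nonempty A] in
lemma bounded_step_zero (τ : Traj S A H) :
    (step γ ψ F etaSeq (fun _ => α) 0 s τ).Bounded F N α 0 where
  dist_le := norm_normStep_sub_le h.step_nonneg _ _
  r_eq := rfl
  rprev_le := h.utility.grad_le _
  lam_le := by simpa [step] using h.norm_occEst_le τ
  r_sub_le := by simp

lemma norm_step_succ_lam_le (hs : s.Bounded F N α n) (τ : Traj S A H) :
    ‖(step γ ψ F etaSeq (fun _ => α) (n + 1) s τ).lam‖ ≤ N + 4 * N ^ 3 * α * (n + 1) := by
  have hη1 := one_sub_etaSeq_succ_nonneg n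
  have hN := h.scale_pos
  have hα := h.step_nonneg
  rw [step_succ_lam]
  refine (norm_add_le _ _).trans ?_
  rw [norm_smul, Real.norm_of_nonneg hη1]
  calc _ ≤ (1 - etaSeq (n + 1)) * (N + 4 * N ^ 3 * α * n) +
        (N * etaSeq (n + 1) + 4 * N ^ 3 * α) := by
        gcongr
        · exact hs.lam_le
        · exact h.norm_lamIncr_le hs (etaSeq_pos _).le hη1 τ
    _ ≤ _ := by
        have : 0 ≤ etaSeq (n + 1) * (4 * N ^ 3 * α * n) :=
          mul_nonneg (etaSeq_pos _).le (by positivity)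
        linarith

lemma norm_step_succ_lam_sub_le (hs : s.Bounded F N α n) (τ : Traj S A H) :
    ‖(step γ ψ F etaSeq (fun _ => α) (n + 1) s τ).lam - s.lam‖ ≤
      2 * N * etaSeq (n + 1) + 12 * N ^ 3 * α := by
  have hη0 := etaSeq_pos (n + 1)
  have hN := h.scale_pos
  have hα := h.step_nonneg
  have h_sub : (step γ ψ F etaSeq (fun _ => α) (n + 1) s τ).lam - s.lam =
      lamIncr γ ψ (etaSeq (n + 1)) s τ - etaSeq (n + 1) • s.lam := by
    rw [step_succ_lam]
    module
  rw [h_sub]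
  refine (norm_sub_le _ _).trans ?_
  rw [norm_smul, Real.norm_of_nonneg hη0.le]
  calc _ ≤ (N * etaSeq (n + 1) + 4 * N ^ 3 * α) +
        etaSeq (n + 1) * (N + 4 * N ^ 3 * α * n) := by
        gcongr
        · exact h.norm_lamIncr_le hs hη0.le (one_sub_etaSeq_succ_nonneg n) τ
        · exact hs.lam_le
    _ = 2 * N * etaSeq (n + 1) + 4 * N ^ 3 * α + 4 * N ^ 3 * α * (etaSeq (n + 1) * n) := by ring
    _ ≤ 2 * N * etaSeq (n + 1) + 4 * N ^ 3 * α + 4 * N ^ 3 * α * 2 := by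
        gcongr
        exact etaSeq_succ_mul_le n
    _ = _ := by ring

lemma bounded_step_succ (hs : s.Bounded F N α n) (τ : Traj S A H) :
    (step γ ψ F etaSeq (fun _ => α) (n + 1) s τ).Bounded F N α (n + 1) where
  dist_le := norm_normStep_sub_le h.step_nonneg _ _
  r_eq := rfl
  rprev_le := h.abs_r_le hs
  lam_le := by exact_mod_cast h.norm_step_succ_lam_le hs τ
  r_sub_le _ i := by
    change |gradient F (step γ ψ F etaSeq (fun _ => α) (n + 1) s τ).lam i - s.r i| ≤ _
    rw [hs.r_eq]
    exact (h.utility.grad_lip _ _ i).trans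
      (mul_le_mul_of_nonneg_left (h.norm_step_succ_lam_sub_le hs τ) h.scale_pos.le)

lemma bounded_run {θ₀ : Param d} (n : ℕ) (ω : Fin (n + 1) → Traj S A H) :
    (run γ ψ F etaSeq (fun _ => α) H θ₀ (n + 1) ω).Bounded F N α n := by
  induction n with
  | zero => exact h.bounded_step_zero _
  | succ n ih => exact h.bounded_step_succ (ih (Fin.init ω)) _

end StepRegime

section Errors

variable {S A : Type*} [Fintype S] [Fintype A] {d : ℕ}

/-- The error of the direction as an estimate of the truncated policy gradient. -/
def errDir (M : MDP S A) (γ : ℝ) (ψ : S → A → Param d → ℝ) (H : ℕ) (s : State S A d) : ℝ :=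
  ‖s.dir - M.meanGrad γ ψ H s.θprev s.rprev‖

variable [DecidableEq S] [DecidableEq A]

/-- The error of the occupancy estimate. -/
def errLam (M : MDP S A) (γ : ℝ) (ψ : S → A → Param d → ℝ) (H : ℕ) (s : State S A d) : ℝ :=
  ‖s.lam - M.truncOcc γ (softmax ψ s.θprev) H‖

variable {ψ : S → A → Param d → ℝ} {F : SAVec S A → ℝ} {γ N α : ℝ} {H n : ℕ} {s : State S A d}
  [Nonempty A]

lemma StepRegime.sum_errLam_sq_le (h : StepRegime γ ψ F H N α) (M : MDP S A)
    (hs : s.Bounded F N α n) :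
    ∑ τ : Traj S A H, M.trajProb (softmax ψ s.θ) H τ *
        errLam M γ ψ H (step γ ψ F etaSeq (fun _ => α) (n + 1) s τ) ^ 2 ≤
      (1 - etaSeq (n + 1)) ^ 2 * errLam M γ ψ H s ^ 2 +
        (10 * N ^ 5 * etaSeq (n + 1) + 36 * N ^ 7 * α) ^ 2 := by
  have hπ := isPolicy_softmax ψ s.θ
  have h_incr (τ : Traj S A H) : ‖lamIncr γ ψ (etaSeq (n + 1)) s τ‖ ≤
      10 * N ^ 5 * etaSeq (n + 1) + 36 * N ^ 7 * α := by
    have hη0 := etaSeq_pos (n + 1)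
    have hα := h.step_nonneg
    have hN := h.scale_pos
    have h_pow5 : N ≤ N ^ 5 := le_self_pow₀ h.one_le (by norm_num)
    have h_pow7 : N ^ 3 ≤ N ^ 7 := pow_le_pow_right₀ h.one_le (by norm_num)
    calc _ ≤ 1 * N * etaSeq (n + 1) + 4 * N ^ 3 * α := by
          simpa only [one_mul] using h.norm_lamIncr_le hs hη0.le (one_sub_etaSeq_succ_nonneg n) τ
      _ ≤ _ := by gcongr <;> norm_num
  have h_var := sum_mul_norm_recursive_sub_sq_le (M.trajProb_nonneg H hπ) (M.sum_trajProb H hπ)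
    h_incr (sum_trajProb_smul_lamIncr M _) s.lam
  simp only [← step_succ_lam (F := F) etaSeq (fun _ => α)] at h_var
  rwa [mul_pow] at h_var

lemma StepRegime.sum_errDir_sq_le (h : StepRegime γ ψ F H N α) (M : MDP S A)
    (hs : s.Bounded F N α n) :
    ∑ τ : Traj S A H, M.trajProb (softmax ψ s.θ) H τ *
        errDir M γ ψ H (step γ ψ F etaSeq (fun _ => α) (n + 1) s τ) ^ 2 ≤
      (1 - etaSeq (n + 1)) ^ 2 * errDir M γ ψ H s ^ 2 +
        (10 * N ^ 5 * etaSeq (n + 1) + 36 * N ^ 7 * α) ^ 2 := by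
  have hπ := isPolicy_softmax ψ s.θ
  have h_var := sum_mul_norm_recursive_sub_sq_le (M.trajProb_nonneg H hπ) (M.sum_trajProb H hπ)
    (h.norm_dirIncr_le hs) (sum_trajProb_smul_dirIncr M γ ψ s _) s.dir
  simp only [← step_succ_dir (F := F) etaSeq (fun _ => α)] at h_var
  rwa [mul_pow] at h_var

end Errors

section Expectation

variable {S A : Type*} [Fintype S] [Fintype A] [DecidableEq S] [DecidableEq A] {d : ℕ}

/-- The expectation of a function of the state of the algorithm after `n` trajectories, for a
constant step size. -/
def expect (M : MDP S A) (γ : ℝ) (ψ : S → A → Param d → ℝ) (F : SAVec S A → ℝ) (α : ℝ) (H : ℕ)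
    (θ₀ : Param d) (n : ℕ) (f : State S A d → ℝ) : ℝ :=
  ∑ ω : Fin n → Traj S A H, runProb M γ ψ F etaSeq (fun _ => α) H θ₀ n ω *
    f (run γ ψ F etaSeq (fun _ => α) H θ₀ n ω)

variable (M : MDP S A) (γ : ℝ) (ψ : S → A → Param d → ℝ) (F : SAVec S A → ℝ) (α : ℝ) (H : ℕ)
  (θ₀ : Param d) (n : ℕ)

lemma expect_succ (f : State S A d → ℝ) :
    expect M γ ψ F α H θ₀ (n + 1) f = ∑ ω : Fin n → Traj S A H,
      runProb M γ ψ F etaSeq (fun _ => α) H θ₀ n ω *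
        ∑ τ : Traj S A H, M.trajProb (softmax ψ (run γ ψ F etaSeq (fun _ => α) H θ₀ n ω).θ) H τ *
          f (step γ ψ F etaSeq (fun _ => α) n (run γ ψ F etaSeq (fun _ => α) H θ₀ n ω) τ) := by
  rw [expect, sum_fin_succ_snoc]
  refine Finset.sum_congr rfl fun ω _ => ?_
  rw [Finset.mul_sum]
  refine Finset.sum_congr rfl fun τ _ => ?_
  simp only [runProb, run, Fin.init_snoc, Fin.snoc_last, mul_assoc]

lemma expect_add (f g : State S A d → ℝ) :
    expect M γ ψ F α H θ₀ n (fun s => f s + g s) =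
      expect M γ ψ F α H θ₀ n f + expect M γ ψ F α H θ₀ n g := by
  simp only [expect, mul_add, Finset.sum_add_distrib]

lemma expect_const_mul (c : ℝ) (f : State S A d → ℝ) :
    expect M γ ψ F α H θ₀ n (fun s => c * f s) = c * expect M γ ψ F α H θ₀ n f := by
  simp only [expect, Finset.mul_sum]
  exact Finset.sum_congr rfl fun _ _ => by ring

variable [Nonempty A]

lemma expect_const (c : ℝ) : expect M γ ψ F α H θ₀ n (fun _ => c) = c := by
  induction n with
  | zero => simp [expect, runProb]
  | succ n ih =>
    rw [expect_succ]
    simpa only [← Finset.sum_mul, M.sum_trajProb H (isPolicy_softmax ψ _), one_mul, expect] using ih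

variable {M γ ψ F α H θ₀ n}

lemma runProb_nonneg (η α : ℕ → ℝ) (n : ℕ) (ω : Fin n → Traj S A H) :
    0 ≤ runProb M γ ψ F η α H θ₀ n ω := by
  induction n with
  | zero => simp [runProb]
  | succ n ih => exact mul_nonneg (ih _) (M.trajProb_nonneg H (isPolicy_softmax ψ _) _)

lemma expect_mono {f g : State S A d → ℝ} (h : ∀ s, f s ≤ g s) :
    expect M γ ψ F α H θ₀ n f ≤ expect M γ ψ F α H θ₀ n g :=
  Finset.sum_le_sum fun _ _ => mul_le_mul_of_nonneg_left (h _) (runProb_nonneg _ _ _ _)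

lemma expect_succ_le_expect {f g : State S A d → ℝ}
    (h : ∀ ω, 0 < runProb M γ ψ F etaSeq (fun _ => α) H θ₀ n ω →
      ∑ τ : Traj S A H, M.trajProb (softmax ψ (run γ ψ F etaSeq (fun _ => α) H θ₀ n ω).θ) H τ *
        f (step γ ψ F etaSeq (fun _ => α) n (run γ ψ F etaSeq (fun _ => α) H θ₀ n ω) τ) ≤
      g (run γ ψ F etaSeq (fun _ => α) H θ₀ n ω)) :
    expect M γ ψ F α H θ₀ (n + 1) f ≤ expect M γ ψ F α H θ₀ n g := by
  rw [expect_succ]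
  refine Finset.sum_le_sum fun ω _ => ?_
  rcases (runProb_nonneg (M := M) (γ := γ) (ψ := ψ) (F := F) (θ₀ := θ₀) etaSeq
    (fun _ => α) n ω).eq_or_lt with h_null | h_pos
  · rw [← h_null, zero_mul, zero_mul]
  · exact mul_le_mul_of_nonneg_left (h ω h_pos) h_pos.le

lemma expect_le_of_expect_sq_le {f : State S A d → ℝ} {c : ℝ} (hc : 0 < c)
    (h : expect M γ ψ F α H θ₀ n (fun s => f s ^ 2) ≤ c ^ 2) :
    expect M γ ψ F α H θ₀ n f ≤ c := by
  have h_young s : f s ≤ (2 * c)⁻¹ * f s ^ 2 + c / 2 := by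
    rw [← sub_nonneg, show (2 * c)⁻¹ * f s ^ 2 + c / 2 - f s = (f s - c) ^ 2 / (2 * c) by
      field_simp; ring]
    positivity
  refine (expect_mono h_young).trans ?_
  rw [expect_add, expect_const_mul, expect_const]
  calc _ ≤ (2 * c)⁻¹ * c ^ 2 + c / 2 := by gcongr
    _ = c := by field_simp; ring

/-- A bound for the expected error of both estimators in the second half of a run of length `T`. -/
def errorLevel (N α : ℝ) (T : ℕ) : ℝ := 40 * N ^ 5 / √(T + 1) + 72 * N ^ 7 * α * √(T + 1)

variable {N : ℝ}

namespace StepRegime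

variable (h : StepRegime γ ψ F H N α)
include h

omit [DecidableEq S] [DecidableEq A] [Nonempty A] in
lemma errorLevel_pos (T : ℕ) : 0 < errorLevel N α T := by
  have := h.scale_pos
  have := h.step_nonneg
  have : (0 : ℝ) < √(T + 1) := Real.sqrt_pos.2 (by positivity)
  unfold errorLevel
  positivity

lemma expect_le_errorLevel {err : State S A d → ℝ}
    (herr : ∀ n (s : State S A d), s.Bounded F N α n →
      ∑ τ : Traj S A H, M.trajProb (softmax ψ s.θ) H τ *
          err (step γ ψ F etaSeq (fun _ => α) (n + 1) s τ) ^ 2 ≤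
        (1 - etaSeq (n + 1)) ^ 2 * err s ^ 2 +
          (10 * N ^ 5 * etaSeq (n + 1) + 36 * N ^ 7 * α) ^ 2)
    {t T : ℕ} (ht : 1 ≤ t) (htT : t ≤ T) (hTt : T + 1 ≤ 2 * (t + 1)) :
    expect M γ ψ F α H θ₀ (t + 1) err ≤ errorLevel N α T := by
  have hN := h.scale_pos
  have hα := h.step_nonneg
  have h_rec n : expect M γ ψ F α H θ₀ (n + 1 + 1) (fun s => err s ^ 2) ≤
      (1 - etaSeq (n + 1)) ^ 2 * expect M γ ψ F α H θ₀ (n + 1) (fun s => err s ^ 2) +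
        (10 * N ^ 5 * etaSeq (n + 1) + 36 * N ^ 7 * α) ^ 2 := by
    refine (expect_succ_le_expect (g := fun s => (1 - etaSeq (n + 1)) ^ 2 * err s ^ 2 +
      (10 * N ^ 5 * etaSeq (n + 1) + 36 * N ^ 7 * α) ^ 2) fun ω _ =>
      herr n _ (h.bounded_run n ω)).trans_eq ?_
    rw [expect_add, expect_const_mul, expect_const]
  refine expect_le_of_expect_sq_le (h.errorLevel_pos T) ?_
  refine (le_sq_of_momentum_recursion
    (V := fun t => expect M γ ψ F α H θ₀ (t + 1) fun s => err s ^ 2) (a := 10 * N ^ 5)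
    (c := 36 * N ^ 7 * α) (by positivity) (by positivity) h_rec ht htT hTt).trans_eq ?_
  rw [errorLevel]
  ring

end StepRegime

end Expectation

section NormalizedAscent

variable {d : ℕ}

/-- The normalized step maximizes the linear model over the ball of radius `α`. -/
lemma sub_normStep_le_of_linear_model {f : Param d → ℝ} {x v : Param d} {α κ : ℝ} (hα : 0 ≤ α)
    (hf : ∀ y, ‖y - x‖ ≤ α → |f y - f x - inner ℝ v (y - x)| ≤ κ) {y : Param d}
    (hy : ‖y - x‖ ≤ α) : f y - f (normStep α x v) ≤ 2 * κ := by
  have h_step := (abs_le.1 (hf _ (norm_normStep_sub_le hα x v))).1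
  have h_near := (abs_le.1 (hf y hy)).2
  have h_opt : inner ℝ v (y - x) ≤ inner ℝ v (normStep α x v - x) := by
    rw [inner_normStep_sub, mul_comm]
    exact (real_inner_le_norm _ _).trans (mul_le_mul_of_nonneg_left hy (norm_nonneg _))
  linarith

end NormalizedAscent

lemma le_of_linear_recursion {x : ℕ → ℝ} {ε c : ℝ} (hε1 : ε ≤ 1) (hc : 0 ≤ c) {m : ℕ} (k : ℕ)
    (h : ∀ n, m ≤ n → n < m + k → x (n + 1) ≤ (1 - ε) * x n + ε * c) :
    x (m + k) ≤ (1 - ε) ^ k * x m + c := by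
  suffices h_excess : x (m + k) - c ≤ (1 - ε) ^ k * (x m - c) by
    linarith [mul_nonneg (pow_nonneg (sub_nonneg.2 hε1) k) hc]
  induction k with
  | zero => simp
  | succ k ih =>
    have h_ih := ih fun n hn hn' => h n hn (by omega)
    have h_last := h (m + k) (by omega) (by omega)
    calc x (m + k + 1) - c ≤ (1 - ε) * (x (m + k) - c) := by linarith
      _ ≤ (1 - ε) * ((1 - ε) ^ k * (x m - c)) :=
        mul_le_mul_of_nonneg_left h_ih (sub_nonneg.2 hε1)
      _ = _ := by ring

section Gap

variable {S A : Type*} [Fintype S] [Fintype A] [DecidableEq S] [DecidableEq A] {d : ℕ}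

/-- The suboptimality of the parameter `θ` with respect to the parameter `θs`. -/
def gap (M : MDP S A) (γ : ℝ) (ψ : S → A → Param d → ℝ) (F : SAVec S A → ℝ) (θs θ : Param d) : ℝ :=
  F (occ M γ ψ θs) - F (occ M γ ψ θ)

variable [Nonempty A] {M : MDP S A} {ψ : S → A → Param d → ℝ} {F : SAVec S A → ℝ}
  {γ N α ℓ εbar : ℝ} {H n : ℕ} {θ₀ θs : Param d} {Θ : Set (Param d)} {s : State S A d}

lemma l1_occ_sub_occ_le (hγ0 : 0 ≤ γ) (hγ1 : γ < 1) (θ θ' : Param d) :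
    l1 (occ M γ ψ θ - occ M γ ψ θ') ≤ 2 * (1 - γ)⁻¹ := by
  have hθ := M.l1_occupancy_le (isPolicy_softmax ψ θ) hγ0 hγ1
  have hθ' := M.l1_occupancy_le (isPolicy_softmax ψ θ') hγ0 hγ1
  refine (l1_sub_le _ _).trans ?_
  simp only [occ]
  linarith

lemma UtilityRegular.gap_le {l L Linf : ℝ} (hF : UtilityRegular F l L Linf) (hγ0 : 0 ≤ γ)
    (hγ1 : γ < 1) (hl : 0 ≤ l) (θs θ : Param d) : gap M γ ψ F θs θ ≤ 2 * l * (1 - γ)⁻¹ := by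
  calc _ ≤ l * l1 (occ M γ ψ θs - occ M γ ψ θ) := (le_abs_self _).trans (hF.abs_sub_le _ _)
    _ ≤ l * (2 * (1 - γ)⁻¹) := by gcongr; exact l1_occ_sub_occ_le hγ0 hγ1 θs θ
    _ = _ := by ring

/-- Concavity along the segment from `λ(θ)` to `λ(θs)`, pulled back by the local inverse. -/
lemma LocallyInvertible.exists_near (hinv : LocallyInvertible M γ ψ θs Θ ℓ εbar)
    (hγ0 : 0 ≤ γ) (hγ1 : γ < 1) (hN : 0 ≤ N) (hγN : (1 - γ)⁻¹ ≤ N) (hℓN : ℓ ≤ N)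
    (hconc : ConcaveOn ℝ (convexHull ℝ (M.occupancySet γ)) F) {ε : ℝ} (hε0 : 0 < ε)
    (hε1 : ε ≤ 1) (hε : ε ≤ εbar) {θ : Param d} (hθ : θ ∈ Θ) :
    ∃ θ', ‖θ' - θ‖ ≤ 2 * N ^ 2 * ε ∧ gap M γ ψ F θs θ' ≤ (1 - ε) * gap M γ ψ F θs θ := by
  obtain ⟨U, V, hU, -, -, hbij, hlip, hseg⟩ := hinv θ hθ
  obtain ⟨θ', hθ'U, hθ'⟩ := hbij.surjOn (hseg ε hε0 hε)
  refine ⟨θ', ?_, ?_⟩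
  · have h_diff : occ M γ ψ θ' - occ M γ ψ θ = ε • (occ M γ ψ θs - occ M γ ψ θ) := by
      rw [hθ']
      module
    have h_diam : ‖occ M γ ψ θs - occ M γ ψ θ‖ ≤ 2 * N :=
      (norm_le_l1 _).trans ((l1_occ_sub_occ_le hγ0 hγ1 _ _).trans (by linarith))
    calc _ ≤ ℓ * ‖occ M γ ψ θ' - occ M γ ψ θ‖ := hlip θ' hθ'U θ hU
      _ = ℓ * (ε * ‖occ M γ ψ θs - occ M γ ψ θ‖) := by
        rw [h_diff, norm_smul, Real.norm_of_nonneg hε0.le]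
      _ ≤ N * (ε * (2 * N)) := by gcongr
      _ = _ := by ring
  · have h_mem θ : occ M γ ψ θ ∈ convexHull ℝ (M.occupancySet γ) :=
      subset_convexHull ℝ _ ⟨_, isPolicy_softmax ψ θ, rfl⟩
    have h_concave :=
      hconc.2 (h_mem θ) (h_mem θs) (sub_nonneg.2 hε1) hε0.le (sub_add_cancel 1 ε)
    rw [← hθ', smul_eq_mul, smul_eq_mul] at h_concave
    simp only [gap]
    linarith

namespace StepRegime

variable (h : StepRegime γ ψ F H N α)
include h

omit [DecidableEq S] [DecidableEq A] [Nonempty A] in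
lemma fraction_le_one : α / (2 * N ^ 2) ≤ 1 := by
  have hN := h.scale_pos
  have hN2 : 1 ≤ N ^ 2 := one_le_pow₀ h.one_le
  rw [div_le_one (by positivity)]
  nlinarith [h.step_le, h.step_nonneg]

lemma gap_le (θ : Param d) : gap M γ ψ F θs θ ≤ 2 * N ^ 2 := by
  have hN := h.scale_pos
  calc _ ≤ 2 * N * (1 - γ)⁻¹ := h.utility.gap_le h.discount_nonneg h.discount_lt_one hN.le θs θ
    _ ≤ 2 * N * N := by gcongr; exact h.inv_le
    _ = _ := by ring

lemma abs_gradient_sub_r_le (hs : s.Bounded F N α n) (i : S × A) :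
    |gradient F (occ M γ ψ s.θ) i - s.r i| ≤
      N * (errLam M γ ψ H s + 2 * N ^ 3 * α + N * γ ^ H) := by
  have hN := h.scale_pos
  have hα := h.step_nonneg
  have hγ := h.discount_nonneg
  have hinv : 0 ≤ (1 - γ)⁻¹ := inv_nonneg.2 (sub_nonneg.2 h.discount_lt_one.le)
  have hπ θ := isPolicy_softmax ψ θ
  have h_tail : ‖occ M γ ψ s.θ - M.truncOcc γ (softmax ψ s.θ) H‖ ≤ N * γ ^ H := by
    refine (norm_le_l1 _).trans
      ((M.l1_occupancy_sub_truncOcc_le (hπ s.θ) hγ h.discount_lt_one H).trans ?_)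
    rw [mul_comm]
    exact mul_le_mul_of_nonneg_right h.inv_le (pow_nonneg hγ H)
  have h_move : ‖M.truncOcc γ (softmax ψ s.θ) H - M.truncOcc γ (softmax ψ s.θprev) H‖ ≤
      2 * N ^ 3 * α := by
    calc _ ≤ 2 * N * ‖s.θ - s.θprev‖ * (1 - γ)⁻¹ ^ 2 :=
          (norm_le_l1 _).trans (M.l1_truncOcc_sub_le (hπ s.θprev) (hπ s.θ) hγ h.discount_lt_one
            (h.policy.sum_abs_softmax_sub_le s.θprev s.θ) H)
      _ ≤ 2 * N * α * N ^ 2 := by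
          gcongr
          · exact hs.dist_le
          · exact h.inv_le
      _ = _ := by ring
  rw [hs.r_eq]
  refine (h.utility.grad_lip _ _ i).trans (mul_le_mul_of_nonneg_left ?_ hN.le)
  rw [show occ M γ ψ s.θ - s.lam = -(s.lam - M.truncOcc γ (softmax ψ s.θprev) H) +
      (M.truncOcc γ (softmax ψ s.θ) H - M.truncOcc γ (softmax ψ s.θprev) H) +
      (occ M γ ψ s.θ - M.truncOcc γ (softmax ψ s.θ) H) by abel]
  refine norm_add₃_le.trans ?_
  rw [norm_neg]
  exact add_le_add_three le_rfl h_move h_tail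

lemma abs_utility_sub_sub_inner_meanGrad_le (hs : s.Bounded F N α n) {θ : Param d}
    (hθ : ‖θ - s.θ‖ ≤ α) :
    |F (occ M γ ψ θ) - F (occ M γ ψ s.θ) - inner ℝ (M.meanGrad γ ψ H s.θ s.r) (θ - s.θ)| ≤
      α * (2 * N ^ 4 * errLam M γ ψ H s + 16 * N ^ 7 * α + 6 * N ^ 5 * γ ^ H) := by
  have hN := h.scale_pos
  have hα := h.step_nonneg
  have hγ := h.discount_nonneg
  have hinv : 0 ≤ (1 - γ)⁻¹ := inv_nonneg.2 (sub_nonneg.2 h.discount_lt_one.le)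
  have h_err : 0 ≤ errLam M γ ψ H s := norm_nonneg _
  have hH := h.horizon_le
  have h_small : 2 * H * N * ‖θ - s.θ‖ ≤ 1 := by
    calc _ ≤ 2 * N * N * α := by gcongr
      _ = 2 * N ^ 2 * α := by ring
      _ ≤ 1 := h.step_le
  refine (M.abs_utility_sub_sub_inner_meanGrad_le h.policy hγ h.discount_lt_one h_small
    (h.abs_r_le hs) h.utility hN.le (h.abs_gradient_sub_r_le hs)).trans ?_
  set e := errLam M γ ψ H s
  have hN1 := h.one_le
  calc _ ≤ 2 * N * (N * γ ^ H * (N ^ 2 + N * N) + N * (e + 2 * N ^ 3 * α + N * γ ^ H) * N ^ 2) *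
        α + (N * (2 * N * N ^ 2) ^ 2 +
          N * N * (2 * N * (N + N ^ 2) + (2 * N * N) ^ 2)) * α ^ 2 := by
        gcongr <;> exact h.inv_le
    _ = α * (2 * N ^ 4 * e + (8 * N ^ 7 + 2 * N ^ 4 + 2 * N ^ 5 + 4 * N ^ 6) * α +
          (4 * N ^ 4 + 2 * N ^ 5) * γ ^ H) := by ring
    _ ≤ α * (2 * N ^ 4 * e + (8 * N ^ 7 + 2 * N ^ 7 + 2 * N ^ 7 + 4 * N ^ 7) * α +
          (4 * N ^ 5 + 2 * N ^ 5) * γ ^ H) := by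
        gcongr <;> norm_num
    _ = _ := by ring

end StepRegime

end Gap

section Contraction

variable {S A : Type*} [Fintype S] [Fintype A] [DecidableEq S] [DecidableEq A] [Nonempty A]
  {d : ℕ} {M : MDP S A} {ψ : S → A → Param d → ℝ} {F : SAVec S A → ℝ} {γ N α ℓ εbar : ℝ}
  {H n : ℕ} {θ₀ θs : Param d} {Θ : Set (Param d)} {s : State S A d}

lemma expect_gap (n : ℕ) :
    expect M γ ψ F α H θ₀ n (fun s => gap M γ ψ F θs s.θ) =
      F (occ M γ ψ θs) - expectedUtility M γ ψ F etaSeq (fun _ => α) H θ₀ n := by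
  calc _ = expect M γ ψ F α H θ₀ n (fun s => F (occ M γ ψ θs) + -1 * F (occ M γ ψ s.θ)) := by
        simp only [gap, neg_one_mul, sub_eq_add_neg]
    _ = F (occ M γ ψ θs) + -1 * expect M γ ψ F α H θ₀ n (fun s => F (occ M γ ψ s.θ)) := by
        rw [expect_add, expect_const_mul, expect_const]
    _ = _ := by rw [neg_one_mul, ← sub_eq_add_neg, expect, expectedUtility]

namespace StepRegime

variable (h : StepRegime γ ψ F H N α) (hα : 0 < α) (hℓN : ℓ ≤ N)
  (hinv : LocallyInvertible M γ ψ θs Θ ℓ εbar) (hε : α / (2 * N ^ 2) ≤ εbar)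
  (hconc : ConcaveOn ℝ (convexHull ℝ (M.occupancySet γ)) F)
include h hα hℓN hinv hε hconc

lemma gap_step_le (hs : s.Bounded F N α n) (hθ : s.θ ∈ Θ) (τ : Traj S A H) :
    gap M γ ψ F θs (step γ ψ F etaSeq (fun _ => α) (n + 1) s τ).θ ≤
      (1 - α / (2 * N ^ 2)) * gap M γ ψ F θs s.θ +
        2 * α * (errDir M γ ψ H (step γ ψ F etaSeq (fun _ => α) (n + 1) s τ) +
          2 * N ^ 4 * errLam M γ ψ H s + 16 * N ^ 7 * α + 6 * N ^ 5 * γ ^ H) := by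
  have hN := h.scale_pos
  set s' := step γ ψ F etaSeq (fun _ => α) (n + 1) s τ
  obtain ⟨θ', h_near, h_gap⟩ := hinv.exists_near h.discount_nonneg h.discount_lt_one hN.le
    h.inv_le hℓN hconc (by positivity) h.fraction_le_one hε hθ
  rw [mul_div_cancel₀ _ (by positivity)] at h_near
  have h_model ϑ (hϑ : ‖ϑ - s.θ‖ ≤ α) :
      |F (occ M γ ψ ϑ) - F (occ M γ ψ s.θ) - inner ℝ s'.dir (ϑ - s.θ)| ≤
        α * (errDir M γ ψ H s' + 2 * N ^ 4 * errLam M γ ψ H s + 16 * N ^ 7 * α +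
          6 * N ^ 5 * γ ^ H) := by
    have h_true := h.abs_utility_sub_sub_inner_meanGrad_le (M := M) hs hϑ
    have h_dir : |inner ℝ (s'.dir - M.meanGrad γ ψ H s.θ s.r) (ϑ - s.θ)| ≤
        errDir M γ ψ H s' * α :=
      (abs_real_inner_le_norm _ _).trans (mul_le_mul_of_nonneg_left hϑ (norm_nonneg _))
    rw [inner_sub_left] at h_dir
    rw [abs_le] at h_true h_dir ⊢
    constructor <;> linarith [h_true.1, h_true.2, h_dir.1, h_dir.2]
  have h_ascent : F (occ M γ ψ θ') - F (occ M γ ψ s'.θ) ≤ _ :=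
    sub_normStep_le_of_linear_model hα.le h_model h_near
  simp only [gap] at h_gap ⊢
  linarith

lemma expect_gap_succ_le {T : ℕ} (hT : T / 2 + 1 ≤ n) (hn : n < T)
    (hΘ : ∀ t < T, ∀ ω : Fin t → Traj S A H,
      0 < runProb M γ ψ F etaSeq (fun _ => α) H θ₀ t ω →
        (run γ ψ F etaSeq (fun _ => α) H θ₀ t ω).θ ∈ Θ) :
    expect M γ ψ F α H θ₀ (n + 1) (fun s => gap M γ ψ F θs s.θ) ≤
      (1 - α / (2 * N ^ 2)) * expect M γ ψ F α H θ₀ n (fun s => gap M γ ψ F θs s.θ) +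
        2 * α * (errorLevel N α T + 2 * N ^ 4 * errorLevel N α T + 16 * N ^ 7 * α +
          6 * N ^ 5 * γ ^ H) := by
  obtain ⟨m, rfl⟩ : ∃ m, n = m + 1 := ⟨n - 1, by omega⟩
  have hN := h.scale_pos
  have h_step : expect M γ ψ F α H θ₀ (m + 1 + 1)
        (fun s => gap M γ ψ F θs s.θ + -(2 * α) * errDir M γ ψ H s) ≤
      expect M γ ψ F α H θ₀ (m + 1) (fun s => (1 - α / (2 * N ^ 2)) * gap M γ ψ F θs s.θ +
        (2 * α * (2 * N ^ 4) * errLam M γ ψ H s +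
          2 * α * (16 * N ^ 7 * α + 6 * N ^ 5 * γ ^ H))) := by
    refine expect_succ_le_expect fun ω hω => ?_
    have hπ := isPolicy_softmax ψ (run γ ψ F etaSeq (fun _ => α) H θ₀ (m + 1) ω).θ
    have h_gap := h.gap_step_le hα hℓN hinv hε hconc (h.bounded_run m ω) (hΘ _ hn ω hω)
    refine (Finset.sum_le_sum fun τ _ =>
      mul_le_mul_of_nonneg_left ?_ (M.trajProb_nonneg H hπ τ)).trans_eq
        (by rw [← Finset.sum_mul, M.sum_trajProb H hπ, one_mul])
    linarith [h_gap τ]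
  rw [expect_add, expect_const_mul, expect_add, expect_const_mul, expect_add,
    expect_const_mul, expect_const] at h_step
  have h_dir : expect M γ ψ F α H θ₀ (m + 1 + 1) (errDir M γ ψ H) ≤ errorLevel N α T :=
    h.expect_le_errorLevel (fun _ _ hs => h.sum_errDir_sq_le M hs) (by omega) (by omega)
      (by omega)
  have h_lam : expect M γ ψ F α H θ₀ (m + 1) (errLam M γ ψ H) ≤ errorLevel N α T :=
    h.expect_le_errorLevel (fun _ _ hs => h.sum_errLam_sq_le M hs) (by omega) (by omega)
      (by omega)
  have h_dir' := mul_le_mul_of_nonneg_left h_dir (by positivity : 0 ≤ 2 * α)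
  have h_lam' := mul_le_mul_of_nonneg_left h_lam (by positivity : 0 ≤ 2 * α * (2 * N ^ 4))
  linarith

omit [DecidableEq S] [DecidableEq A] [Nonempty A] hα hℓN hinv hε hconc in
lemma errorLevel_add_le {T : ℕ} (hγH : γ ^ H ≤ 1 / (T + 1)) :
    4 * N ^ 2 * (errorLevel N α T + 2 * N ^ 4 * errorLevel N α T + 16 * N ^ 7 * α +
      6 * N ^ 5 * γ ^ H) ≤ 1000 * N ^ 13 * (1 / √(T + 1) + α * √(T + 1)) := by
  have hN := h.scale_pos
  have hN1 := h.one_le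
  have hα := h.step_nonneg
  have h_root : (1 : ℝ) ≤ √(T + 1) :=
    Real.one_le_sqrt.2 (by linarith [(Nat.cast_nonneg T : (0 : ℝ) ≤ T)])
  have h_tail : γ ^ H ≤ 1 / √(T + 1) :=
    hγH.trans (one_div_le_one_div_of_le (by positivity)
      (Real.sqrt_le_iff.2 ⟨by positivity, by nlinarith [(Nat.cast_nonneg T : (0 : ℝ) ≤ T)]⟩))
  have h_step : α ≤ α * √(T + 1) := le_mul_of_one_le_right hα h_root
  have h_level : errorLevel N α T =
      40 * N ^ 5 * (1 / √(T + 1)) + 72 * N ^ 7 * (α * √(T + 1)) := by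
    rw [errorLevel]
    ring
  set z := 1 / √((T : ℝ) + 1)
  have : 0 ≤ z := by positivity
  set v := α * √((T : ℝ) + 1)
  have : 0 ≤ v := by positivity
  rw [h_level]
  calc _ ≤ 4 * N ^ 2 * (40 * N ^ 5 * z + 72 * N ^ 7 * v +
        2 * N ^ 4 * (40 * N ^ 5 * z + 72 * N ^ 7 * v) + 16 * N ^ 7 * v + 6 * N ^ 5 * z) := by
        gcongr
    _ = (184 * N ^ 7 + 320 * N ^ 11) * z + (352 * N ^ 9 + 576 * N ^ 13) * v := by ring
    _ ≤ (184 * N ^ 13 + 320 * N ^ 13) * z + (352 * N ^ 13 + 576 * N ^ 13) * v := by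
        gcongr <;> norm_num
    _ ≤ _ := by
        have : 0 ≤ N ^ 13 * z := by positivity
        have : 0 ≤ N ^ 13 * v := by positivity
        linarith

/-- The initial gap is forgotten geometrically over the second half of the run, in which the
estimators have reached their final accuracy. -/
theorem sub_expectedUtility_le {T : ℕ} (hT : 2 ≤ T) (hγH : γ ^ H ≤ 1 / (T + 1))
    (hΘ : ∀ t < T, ∀ ω : Fin t → Traj S A H,
      0 < runProb M γ ψ F etaSeq (fun _ => α) H θ₀ t ω →
        (run γ ψ F etaSeq (fun _ => α) H θ₀ t ω).θ ∈ Θ) :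
    F (occ M γ ψ θs) - expectedUtility M γ ψ F etaSeq (fun _ => α) H θ₀ T ≤
      2 * N ^ 2 * (1 - α / (2 * N ^ 2)) ^ (T - (T / 2 + 1)) +
        1000 * N ^ 13 * (1 / √(T + 1) + α * √(T + 1)) := by
  have hN := h.scale_pos
  have hγ := h.discount_nonneg
  have h_level := h.errorLevel_pos T
  have h_forget := le_of_linear_recursion (m := T / 2 + 1)
    (x := fun n => expect M γ ψ F α H θ₀ n (fun s => gap M γ ψ F θs s.θ))
    (c := 4 * N ^ 2 * (errorLevel N α T + 2 * N ^ 4 * errorLevel N α T + 16 * N ^ 7 * α +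
      6 * N ^ 5 * γ ^ H)) h.fraction_le_one (by positivity) (T - (T / 2 + 1))
    fun n hn hn' => by
      refine (h.expect_gap_succ_le hα hℓN hinv hε hconc hn (by omega) hΘ).trans_eq ?_
      field_simp
      ring
  rw [show T / 2 + 1 + (T - (T / 2 + 1)) = T by omega, expect_gap] at h_forget
  have h_init : expect M γ ψ F α H θ₀ (T / 2 + 1) (fun s => gap M γ ψ F θs s.θ) ≤ 2 * N ^ 2 :=
    (expect_mono fun s => h.gap_le s.θ).trans_eq (expect_const M γ ψ F α H θ₀ _ _)
  have h_decay := mul_le_mul_of_nonneg_left h_init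
    (pow_nonneg (sub_nonneg.2 h.fraction_le_one) (T - (T / 2 + 1)))
  linarith [h.errorLevel_add_le hγH]

end StepRegime

end Contraction

section Asymptotics

open Filter Topology

lemma eventually_mul_polylog_mul_rpow_le {p q b : ℝ} (hpq : p < q) (hb : 0 < b) (k : ℕ) (c : ℝ) :
    ∀ᶠ x : ℝ in atTop, c * (1 + Real.log x) ^ k * x ^ p ≤ b * x ^ q := by
  have h_one : (fun _ : ℝ => (1 : ℝ)) =O[atTop] Real.log :=
    Asymptotics.IsLittleO.isBigO <| (Asymptotics.isLittleO_const_left_of_ne one_ne_zero).2 <|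
      tendsto_norm_atTop_atTop.comp Real.tendsto_log_atTop
  have h_log : (fun x : ℝ => (1 + Real.log x) ^ k) =o[atTop] fun x => x ^ (q - p) := by
    refine ((h_one.add (Asymptotics.isBigO_refl _ _)).pow k).trans_isLittleO ?_
    simpa only [Real.rpow_natCast] using isLittleO_log_rpow_rpow_atTop (k : ℝ) (sub_pos.2 hpq)
  filter_upwards [(h_log.const_mul_left c).def hb, eventually_gt_atTop 0] with x h_le hx
  rw [Real.norm_eq_abs, Real.norm_of_nonneg (Real.rpow_nonneg hx.le _)] at h_le
  calc _ ≤ b * x ^ (q - p) * x ^ p :=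
        mul_le_mul_of_nonneg_right ((le_abs_self _).trans h_le) (Real.rpow_nonneg hx.le _)
    _ = _ := by rw [mul_assoc, ← Real.rpow_add hx, sub_add_cancel]

lemma eventually_exp_neg_mul_rpow_le {p c b : ℝ} (hp : 0 < p) (hc : 0 < c) (hb : 0 < b) (q : ℝ) :
    ∀ᶠ x : ℝ in atTop, Real.exp (-(c * x ^ p)) ≤ b * x ^ q := by
  have h_zero := (tendsto_rpow_mul_exp_neg_mul_atTop_nhds_zero (-q / p) c hc).comp
    (tendsto_rpow_atTop hp)
  filter_upwards [h_zero.eventually_le_const hb, eventually_gt_atTop 0] with x h_le hx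
  rw [Function.comp_apply, ← Real.rpow_mul hx.le, mul_div_cancel₀ _ hp.ne', neg_mul,
    Real.rpow_neg hx.le, inv_mul_eq_div, div_le_iff₀ (Real.rpow_pos_of_pos hx q)] at h_le
  exact h_le

/-- The bound on the optimality gap after `x` iterations with step size `α`, when `N` dominates the
horizon and the regularity constants: the forgotten initial gap and the error of the estimators. -/
def convergenceBound (N α x : ℝ) : ℝ :=
  2 * N ^ 2 * Real.exp (-(α * x / (8 * N ^ 2))) + 1000 * N ^ 13 * (1 / √x + α * √x)

/-- An exponent halfway between the one claimed, `2 a - 3 / 2`, and the one of the step size term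
of `convergenceBound`, `a - 1 / 2`. One half of the slack absorbs the powers of the logarithm, the
other one the constants. -/
def midExponent (a : ℝ) : ℝ := 3 / 2 * a - 1

lemma eventually_two_mul_sq_mul_step_le {K α₀ a : ℝ} (ha : 0 < a) :
    ∀ᶠ x : ℝ in atTop, 2 * (K * (1 + Real.log x)) ^ 2 * (α₀ / x ^ a) ≤ 1 := by
  filter_upwards [eventually_mul_polylog_mul_rpow_le ha one_pos 2 (2 * K ^ 2 * α₀),
    eventually_gt_atTop 0] with x h_le hx
  rw [Real.rpow_zero, mul_one, one_mul] at h_le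
  rw [← mul_div_assoc, div_le_one (Real.rpow_pos_of_pos hx a)]
  linarith

lemma eventually_forgetting_le {K α₀ a b : ℝ} (hK : 0 < K) (hα₀ : 0 < α₀) (ha : a < 1)
    (hb : 0 < b) (q : ℝ) :
    ∀ᶠ x : ℝ in atTop, 2 * (K * (1 + Real.log x)) ^ 2 *
      Real.exp (-(α₀ / x ^ a * x / (8 * (K * (1 + Real.log x)) ^ 2))) ≤ b * x ^ q := by
  have h_exponent := eventually_mul_polylog_mul_rpow_le (p := (1 - a) / 2) (q := 1 - a)
    (by linarith) hα₀ 2 (8 * K ^ 2)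
  have h_exp := eventually_exp_neg_mul_rpow_le (p := (1 - a) / 2) (by linarith) one_pos one_pos
    (q - 1)
  have h_log := eventually_mul_polylog_mul_rpow_le (sub_one_lt q) hb 2 (2 * K ^ 2)
  filter_upwards [h_exponent, h_exp, h_log, eventually_ge_atTop 1]
    with x h_exponent h_exp h_log hx1
  have hx : 0 < x := by linarith
  have hL : 0 < 1 + Real.log x := by linarith [Real.log_nonneg hx1]
  have h_arg : 1 * x ^ ((1 - a) / 2) ≤ α₀ / x ^ a * x / (8 * (K * (1 + Real.log x)) ^ 2) := by
    rw [le_div_iff₀ (by positivity), div_mul_eq_mul_div, mul_div_assoc]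
    nth_rw 3 [← Real.rpow_one x]
    rw [← Real.rpow_sub hx]
    linarith
  calc _ ≤ 2 * (K * (1 + Real.log x)) ^ 2 * (1 * x ^ (q - 1)) := by
        gcongr
        exact (Real.exp_le_exp.2 (neg_le_neg h_arg)).trans h_exp
    _ ≤ _ := by linarith

lemma eventually_estimation_le {K α₀ a q b : ℝ} (hq : q < 1 / 2) (hqa : q < a - 1 / 2)
    (hb : 0 < b) :
    ∀ᶠ x : ℝ in atTop,
      1000 * (K * (1 + Real.log x)) ^ 13 * (1 / √x + α₀ / x ^ a * √x) ≤ b * x ^ (-q) := by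
  have h_noise := eventually_mul_polylog_mul_rpow_le (p := -(1 / 2)) (q := -q) (by linarith)
    (half_pos hb) 13 (1000 * K ^ 13)
  have h_drift := eventually_mul_polylog_mul_rpow_le (p := 1 / 2 - a) (q := -q) (by linarith)
    (half_pos hb) 13 (1000 * K ^ 13 * α₀)
  filter_upwards [h_noise, h_drift, eventually_gt_atTop 0] with x h_noise h_drift hx
  have h_root : 1 / √x = x ^ (-(1 / 2) : ℝ) := by
    rw [Real.sqrt_eq_rpow, Real.rpow_neg hx.le, one_div]
  have h_step : α₀ / x ^ a * √x = α₀ * x ^ (1 / 2 - a) := by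
    rw [Real.sqrt_eq_rpow, Real.rpow_sub hx]
    ring
  rw [h_root, h_step]
  linarith

lemma eventually_convergenceBound_le {K α₀ a : ℝ} (hK : 0 < K) (hα₀ : 0 < α₀) (ha : a < 1) :
    ∀ᶠ x : ℝ in atTop,
      convergenceBound (K * (1 + Real.log x)) (α₀ / x ^ a) x ≤ x ^ (-midExponent a) := by
  have h_forget := eventually_forgetting_le hK hα₀ ha one_half_pos (-midExponent a)
  have h_est := eventually_estimation_le (K := K) (α₀ := α₀) (a := a) (q := midExponent a)
    (by rw [midExponent]; linarith) (by rw [midExponent]; linarith) one_half_pos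
  filter_upwards [h_forget, h_est] with x h_forget h_est
  rw [convergenceBound]
  linarith

lemma eventually_natCast_add_one {p : ℝ → Prop} (h : ∀ᶠ x in atTop, p x) :
    ∀ᶠ T : ℕ in atTop, p (T + 1) :=
  (tendsto_atTop_add_const_right _ 1 tendsto_natCast_atTop_atTop).eventually h

lemma eventually_rpow_neg_midExponent_le_rate {C α₀ γ a : ℝ} (hC : 0 < C) (hα₀ : 0 < α₀)
    (hγ1 : γ < 1) (ha : a < 1) :
    ∀ᶠ T : ℕ in atTop, ((T : ℝ) + 1) ^ (-midExponent a) ≤ C * rate α₀ γ a T := by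
  have hγ : 0 < 1 - γ := sub_pos.2 hγ1
  filter_upwards [eventually_natCast_add_one (eventually_mul_polylog_mul_rpow_le
    (p := -midExponent a) (q := -(2 * a - 3 / 2)) (by rw [midExponent]; linarith)
    (by positivity : 0 < C * (α₀ ^ 2 / (1 - γ) ^ 3)) 0 1)] with T h_le
  rw [pow_zero, one_mul, one_mul, Real.rpow_neg (by positivity) (2 * a - 3 / 2)] at h_le
  refine h_le.trans_eq ?_
  rw [rate]
  field_simp

lemma rate_pos {α₀ γ : ℝ} (hα₀ : α₀ ≠ 0) (hγ1 : γ < 1) (a : ℝ) (T : ℕ) : 0 < rate α₀ γ a T := by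
  have : 0 < 1 - γ := sub_pos.2 hγ1
  rw [rate]
  positivity

lemma exists_forall_lt_le_mul {r : ℕ → ℝ} (hr : ∀ n, 0 < r n) (C D : ℝ) (n₀ : ℕ) :
    ∃ K, C ≤ K ∧ ∀ n < n₀, D ≤ K * r n := by
  obtain ⟨B, hB⟩ := ((Set.finite_Iio n₀).image fun n => D / r n).bddAbove
  refine ⟨max C B, le_max_left _ _, fun n hn => (div_le_iff₀ (hr n)).1 ?_⟩
  exact (hB (Set.mem_image_of_mem _ hn)).trans (le_max_right _ _)

section Horizon

variable {γ : ℝ}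

lemma horizon_le {K : ℝ} (hγ1 : γ < 1) (hK : (1 - γ)⁻¹ + 1 ≤ K) (T : ℕ) :
    (horizon γ T : ℝ) ≤ K * (1 + Real.log (T + 1)) := by
  have hγ : 0 < 1 - γ := sub_pos.2 hγ1
  have h_inv : 0 < (1 - γ)⁻¹ := inv_pos.2 hγ
  have h_log : 0 ≤ Real.log ((T : ℝ) + 1) := Real.log_nonneg (by simp)
  have h_ceil := (Nat.ceil_lt_add_one (div_nonneg h_log hγ.le)).le
  rw [div_eq_mul_inv] at h_ceil
  calc _ ≤ Real.log (T + 1) * (1 - γ)⁻¹ + 1 := h_ceil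
    _ ≤ Real.log (T + 1) * K + K := by gcongr <;> linarith
    _ = _ := by ring

lemma pow_horizon_le (hγ0 : 0 ≤ γ) (hγ1 : γ < 1) (T : ℕ) :
    γ ^ horizon γ T ≤ 1 / ((T : ℝ) + 1) := by
  have h_horizon : Real.log ((T : ℝ) + 1) ≤ horizon γ T * (1 - γ) :=
    (div_le_iff₀ (sub_pos.2 hγ1)).1 (Nat.le_ceil _)
  calc γ ^ horizon γ T ≤ Real.exp (-(1 - γ)) ^ horizon γ T := by
        gcongr
        linarith [Real.add_one_le_exp (-(1 - γ))]
    _ = Real.exp (-(horizon γ T * (1 - γ))) := by rw [← Real.exp_nat_mul, mul_neg]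
    _ ≤ Real.exp (-Real.log (T + 1)) := Real.exp_le_exp.2 (neg_le_neg h_horizon)
    _ = 1 / ((T : ℝ) + 1) := by rw [Real.exp_neg, Real.exp_log (by positivity), one_div]

lemma eventually_ceil_mul_horizon_le {C u : ℝ} (hC : 0 < C) (hγ1 : γ < 1) (hu : 1 < u) :
    ∀ᶠ x : ℝ in atTop, (⌈x⌉₊ : ℝ) * horizon γ ⌈x⌉₊ ≤ C * x ^ u := by
  set K := (1 - γ)⁻¹ + 1
  have : 0 ≤ K := by linarith [inv_pos.2 (sub_pos.2 hγ1)]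
  filter_upwards [eventually_mul_polylog_mul_rpow_le hu hC 1 (4 * K), eventually_ge_atTop 2]
    with x h_le hx
  have h_ceil := (Nat.ceil_lt_add_one (by linarith : 0 ≤ x)).le
  have h_log : Real.log (⌈x⌉₊ + 1) ≤ 2 * Real.log x := by
    rw [← Nat.cast_two, ← Real.log_pow]
    exact Real.log_le_log (by positivity) (by nlinarith)
  have : 0 ≤ Real.log x := Real.log_nonneg (by linarith)
  calc _ ≤ (2 * x) * (K * (1 + Real.log (⌈x⌉₊ + 1))) := by
        gcongr
        · linarith
        · exact horizon_le hγ1 le_rfl _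
    _ ≤ (2 * x) * (K * (2 + 2 * Real.log x)) := by gcongr; norm_num
    _ = 4 * K * (1 + Real.log x) ^ 1 * x ^ (1 : ℝ) := by rw [Real.rpow_one]; ring
    _ ≤ _ := h_le

end Horizon

section IterationCount

/-- A number of iterations after which the gap is at most `ε`: the inverse function of
`T ↦ T ^ (-midExponent a)`, rounded up. -/
def iterationCount (a ε : ℝ) : ℕ := ⌈ε ^ (-(midExponent a)⁻¹)⌉₊

variable {a : ℝ} (ha : 3 / 4 < a)
include ha

lemma midExponent_pos : 0 < midExponent a := by
  rw [midExponent]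
  linarith

lemma rpow_neg_midExponent_le_of_iterationCount_le {ε : ℝ} (hε : 0 < ε) {T : ℕ}
    (hT : iterationCount a ε ≤ T) : ((T : ℝ) + 1) ^ (-midExponent a) ≤ ε := by
  have hq := midExponent_pos ha
  have h_le : ε ^ (-(midExponent a)⁻¹) ≤ (T : ℝ) + 1 :=
    ((Nat.le_ceil _).trans (Nat.cast_le.2 hT)).trans (le_add_of_nonneg_right zero_le_one)
  have h_anti := Real.rpow_le_rpow_of_nonpos (Real.rpow_pos_of_pos hε _) h_le
    (neg_nonpos.2 hq.le)
  rwa [← Real.rpow_mul hε.le, neg_mul_neg, inv_mul_cancel₀ hq.ne', Real.rpow_one] at h_anti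

lemma eventually_iterationCount_mul_horizon_le {C γ : ℝ} (hC : 0 < C) (hγ1 : γ < 1) (ha1 : a < 1) :
    ∀ᶠ ε : ℝ in 𝓝[>] 0, (iterationCount a ε : ℝ) * horizon γ (iterationCount a ε) ≤
      C * ε ^ (-2 / (4 * a - 3)) := by
  have hq := midExponent_pos ha
  have h_rate : 0 < 2 * a - 3 / 2 := by linarith
  have h_exponent : 1 < midExponent a / (2 * a - 3 / 2) := by
    rw [one_lt_div h_rate, midExponent]
    linarith
  filter_upwards [(tendsto_rpow_neg_nhdsGT_zero (neg_lt_zero.2 (inv_pos.2 hq))).eventually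
    (eventually_ceil_mul_horizon_le hC hγ1 h_exponent), self_mem_nhdsWithin] with ε h_cost hε
  refine h_cost.trans_eq ?_
  rw [← Real.rpow_mul (le_of_lt hε)]
  congr 2
  rw [show 4 * a - 3 = 2 * (2 * a - 3 / 2) by ring]
  field_simp

lemma eventually_le_iterationCount (T : ℕ) : ∀ᶠ ε : ℝ in 𝓝[>] 0, T ≤ iterationCount a ε := by
  have hq := midExponent_pos ha
  filter_upwards [(tendsto_rpow_neg_nhdsGT_zero
    (neg_lt_zero.2 (inv_pos.2 hq))).eventually_ge_atTop (T : ℝ)] with ε h_le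
  exact_mod_cast h_le.trans (Nat.le_ceil _)

end IterationCount

end Asymptotics

section MonotoneConstants

variable {S A : Type*} {l l' L L' Linf Linf' : ℝ}

lemma PolicyRegular.mono {d : ℕ} {ψ : S → A → Param d → ℝ} (h : PolicyRegular ψ l L)
    (hl : l ≤ l') (hL : L ≤ L') : PolicyRegular ψ l' L' where
  contDiff := h.contDiff
  grad_le s a θ := (h.grad_le s a θ).trans hl
  hess_le s a θ := (h.hess_le s a θ).trans hL

lemma UtilityRegular.mono [Fintype S] [Fintype A] {F : SAVec S A → ℝ}
    (h : UtilityRegular F l L Linf) (hl : l ≤ l') (hL : L ≤ L') (hLinf : Linf ≤ Linf') :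
    UtilityRegular F l' L' Linf' where
  differentiable := h.differentiable
  grad_le μ i := (h.grad_le μ i).trans hl
  grad_lip μ ν i := (h.grad_lip μ ν i).trans (by gcongr)
  grad_lip_one μ ν i := (h.grad_lip_one μ ν i).trans (by gcongr)

end MonotoneConstants

section OptimalityGap

section

variable {S A : Type*} [Fintype S] [Fintype A] [DecidableEq S] [DecidableEq A] [Nonempty A]
  {d T : ℕ} {M : MDP S A} {ψ : S → A → Param d → ℝ} {F : SAVec S A → ℝ}
  {γ K α₀ a ℓ εbar : ℝ} {θ₀ θs : Param d} {Θ : Set (Param d)}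

lemma one_sub_pow_second_half_le_exp {ε : ℝ} (hε0 : 0 ≤ ε) (hε1 : ε ≤ 1) (hT : 5 ≤ T) :
    (1 - ε) ^ (T - (T / 2 + 1)) ≤ Real.exp (-(ε * (T + 1) / 4)) := by
  have h_quarter : (T : ℝ) + 1 ≤ 4 * (T - (T / 2 + 1) : ℕ) := by
    exact_mod_cast (by omega : T + 1 ≤ 4 * (T - (T / 2 + 1)))
  calc _ ≤ Real.exp (-ε) ^ (T - (T / 2 + 1)) :=
        pow_le_pow_left₀ (by linarith) (Real.one_sub_le_exp_neg ε) _
    _ = Real.exp (-(ε * (T - (T / 2 + 1) : ℕ))) := by rw [← Real.exp_nat_mul]; ring_nf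
    _ ≤ _ := Real.exp_le_exp.2 (by linarith [mul_le_mul_of_nonneg_left h_quarter hε0])

lemma div_two_mul_sq_le {N α : ℝ} (hγ1 : γ < 1) (hN : (1 - γ)⁻¹ ≤ N) (hℓ : 0 < ℓ) (hℓN : ℓ ≤ N)
    (hα : 0 ≤ α) : α / (2 * N ^ 2) ≤ α * (1 - γ) / (2 * ℓ) := by
  have hγ : 0 < 1 - γ := sub_pos.2 hγ1
  have h_le : ℓ * (1 - γ)⁻¹ ≤ N ^ 2 := by
    rw [sq]
    gcongr
    exact hℓ.le.trans hℓN
  calc _ ≤ α / (2 * (ℓ * (1 - γ)⁻¹)) := by gcongr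
    _ = _ := by field_simp

lemma optGap_le_const {l L Linf : ℝ} (hF : UtilityRegular F l L Linf) (hγ0 : 0 ≤ γ) (hγ1 : γ < 1)
    (hl : 0 ≤ l) : optGap M γ ψ F θ₀ θs α₀ a T ≤ 2 * l * (1 - γ)⁻¹ :=
  (expect_gap T).symm.trans_le <| (expect_mono fun s => hF.gap_le hγ0 hγ1 hl θs s.θ).trans_eq
    (expect_const M γ ψ F _ _ θ₀ T _)

lemma optGap_le_convergenceBound (hγ0 : 0 ≤ γ) (hγ1 : γ < 1) (hα₀ : 0 < α₀) (hℓ : 0 < ℓ)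
    (hK : 1 ≤ K) (hγK : (1 - γ)⁻¹ + 1 ≤ K) (hℓK : ℓ ≤ K)
    (hψ : PolicyRegular ψ K K) (hF : UtilityRegular F K K K)
    (hconc : ConcaveOn ℝ (convexHull ℝ (M.occupancySet γ)) F)
    (hit : IteratesIn M γ ψ F θ₀ α₀ a T Θ) (hinv : LocallyInvertible M γ ψ θs Θ ℓ εbar)
    (hε : α₀ * (1 - γ) / (2 * ℓ * ((T : ℝ) + 1) ^ a) ≤ εbar) (hT : 5 ≤ T)
    (h_step : 2 * (K * (1 + Real.log (T + 1))) ^ 2 * (α₀ / ((T : ℝ) + 1) ^ a) ≤ 1) :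
    optGap M γ ψ F θ₀ θs α₀ a T ≤
      convergenceBound (K * (1 + Real.log (T + 1))) (α₀ / ((T : ℝ) + 1) ^ a) (T + 1) := by
  have hKN : K ≤ K * (1 + Real.log (T + 1)) :=
    le_mul_of_one_le_right (by linarith) (by linarith [Real.log_nonneg (by simp : 1 ≤ (T : ℝ) + 1)])
  have h_horizon := horizon_le hγ1 hγK T
  have hα : 0 < α₀ / ((T : ℝ) + 1) ^ a := by positivity
  set N := K * (1 + Real.log (T + 1))
  have h : StepRegime γ ψ F (horizon γ T) N (α₀ / ((T : ℝ) + 1) ^ a) :=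
    { discount_nonneg := hγ0
      discount_lt_one := hγ1
      one_le := hK.trans hKN
      inv_le := by linarith
      horizon_le := h_horizon
      policy := hψ.mono hKN hKN
      utility := hF.mono hKN hKN hKN
      step_nonneg := hα.le
      step_le := h_step }
  have h_fraction : α₀ / ((T : ℝ) + 1) ^ a / (2 * N ^ 2) ≤ εbar := by
    refine ((div_two_mul_sq_le hγ1 h.inv_le hℓ (hℓK.trans hKN) hα.le).trans_eq ?_).trans hε
    field_simp
  refine (h.sub_expectedUtility_le hα (hℓK.trans hKN) hinv h_fraction hconc (by omega)
    (pow_horizon_le hγ0 hγ1 T) hit).trans ?_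
  have h_forget := one_sub_pow_second_half_le_exp
    (div_nonneg hα.le (by positivity)) h.fraction_le_one hT
  rw [convergenceBound]
  gcongr
  refine h_forget.trans_eq ?_
  congr 2
  field_simp
  ring

end

theorem exists_forall_optGap_le_rpow {lψ Lψ lF LF LFinf ℓ a γ α₀ : ℝ} (hℓ : 0 < ℓ) (ha0 : 0 < a)
    (ha1 : a < 1) (hγ0 : 0 ≤ γ) (hγ1 : γ < 1) (hα₀ : 0 < α₀) :
    ∃ T₁ : ℕ, ∀ (S A : Type*) [Fintype S] [Fintype A] [DecidableEq S] [DecidableEq A] [Nonempty A]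
      (M : MDP S A) (d : ℕ) (ψ : S → A → Param d → ℝ) (F : SAVec S A → ℝ) (θ₀ θs : Param d)
      (Θ : Set (Param d)) (εbar : ℝ) (T : ℕ),
      PolicyRegular ψ lψ Lψ →
      UtilityRegular F lF LF LFinf →
      ConcaveOn ℝ (convexHull ℝ (M.occupancySet γ)) F →
      IteratesIn M γ ψ F θ₀ α₀ a T Θ →
      LocallyInvertible M γ ψ θs Θ ℓ εbar →
      α₀ * (1 - γ) / (2 * ℓ * ((T : ℝ) + 1) ^ a) ≤ εbar →
      T₁ ≤ T → optGap M γ ψ F θ₀ θs α₀ a T ≤ ((T : ℝ) + 1) ^ (-midExponent a) := by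
  obtain ⟨K, hK⟩ := ({lψ, Lψ, lF, LF, LFinf, ℓ, (1 - γ)⁻¹ + 1} : Set ℝ).toFinite.bddAbove
  have h_inv : 0 < (1 - γ)⁻¹ := inv_pos.2 (sub_pos.2 hγ1)
  have hγK : (1 - γ)⁻¹ + 1 ≤ K := hK (by simp)
  obtain ⟨T₁, hT₁⟩ := Filter.eventually_atTop.1 <|
    (eventually_natCast_add_one ((eventually_two_mul_sq_mul_step_le (K := K) ha0).and
      (eventually_convergenceBound_le (K := K) (by linarith) hα₀ ha1))).and
    (Filter.eventually_ge_atTop 5)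
  refine ⟨T₁, fun S A _ _ _ _ _ M d ψ F θ₀ θs Θ εbar T hψ hF hconc hit hinv hε hT => ?_⟩
  obtain ⟨⟨h_step, h_bound⟩, hT5⟩ := hT₁ T hT
  exact (optGap_le_convergenceBound hγ0 hγ1 hα₀ hℓ (by linarith) hγK (hK (by simp))
    (hψ.mono (hK (by simp)) (hK (by simp)))
    (hF.mono (hK (by simp)) (hK (by simp)) (hK (by simp)))
    hconc hit hinv hε hT5 h_step).trans h_bound

end OptimalityGap

end NVRPG

end

open NVRPG in
theorem mainTheorem2_general (lψ Lψ lF LF LFinf : ℝ) {ℓ C a γ α₀ : ℝ} (hℓ : 0 < ℓ) (hC : 0 < C)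
    (ha0 : 0 < a) (ha1 : a < 1) (hγ0 : 0 ≤ γ) (hγ1 : γ < 1) (hα₀ : 0 < α₀) :
    ∃ (K : ℝ) (T₀ : ℕ) (ε₀ : ℝ) (Tε : ℝ → ℕ), 0 < K ∧ 0 < ε₀ ∧
      (3 / 4 < a → ∀ ε : ℝ, 0 < ε → ε ≤ ε₀ →
        (Tε ε : ℝ) * (horizon γ (Tε ε) : ℝ) ≤ C * ε ^ (-2 / (4 * a - 3))) ∧
      ∀ (S A : Type*) [Fintype S] [Fintype A] [DecidableEq S] [DecidableEq A] [Nonempty A]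
        (M : MDP S A) (d : ℕ) (ψ : S → A → Param d → ℝ) (F : SAVec S A → ℝ)
        (θ₀ θs : Param d) (Θ : Set (Param d)) (εbar : ℝ) (T : ℕ),
        PolicyRegular ψ lψ Lψ →
        UtilityRegular F lF LF LFinf →
        ConcaveOn ℝ (convexHull ℝ (M.occupancySet γ)) F →
        IteratesIn M γ ψ F θ₀ α₀ a T Θ →
        LocallyInvertible M γ ψ θs Θ ℓ εbar →
        α₀ * (1 - γ) / (2 * ℓ * ((T : ℝ) + 1) ^ a) ≤ εbar →
        optGap M γ ψ F θ₀ θs α₀ a T ≤ K * rate α₀ γ a T ∧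
        (T₀ ≤ T → optGap M γ ψ F θ₀ θs α₀ a T ≤ C * rate α₀ γ a T) ∧
        (3 / 4 < a → ∀ ε : ℝ, 0 < ε → ε ≤ ε₀ → Tε ε ≤ T →
          optGap M γ ψ F θ₀ θs α₀ a T ≤ ε) := by
  have h_pos := rate_pos hα₀.ne' hγ1 a
  obtain ⟨T₁, h_mid⟩ := exists_forall_optGap_le_rpow hℓ ha0 ha1 hγ0 hγ1 hα₀
  obtain ⟨T₂, h_mid_rate⟩ := Filter.eventually_atTop.1
    (eventually_rpow_neg_midExponent_le_rate hC hα₀ hγ1 ha1)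
  obtain ⟨K, hCK, h_few⟩ :=
    exists_forall_lt_le_mul h_pos C (2 * max lF 0 * (1 - γ)⁻¹) (max T₁ T₂)
  obtain ⟨ε₀, hε₀, h_count⟩ := mem_nhdsGT_iff_exists_Ioc_subset.1 <|
    Filter.eventually_imp_distrib_left.2 fun ha : 3 / 4 < a =>
      (eventually_iterationCount_mul_horizon_le ha hC hγ1 ha1).and
        (eventually_le_iterationCount ha T₁)
  refine ⟨K, max T₁ T₂, ε₀, iterationCount a, hC.trans_le hCK, hε₀,
    fun ha ε hε hε' => (h_count ⟨hε, hε'⟩ ha).1,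
    fun S A _ _ _ _ _ M d ψ F θ₀ θs Θ εbar T hψ hF hconc hit hinv hεbar => ?_⟩
  specialize h_mid S A M d ψ F θ₀ θs Θ εbar T hψ hF hconc hit hinv hεbar
  have h_rate (hT : max T₁ T₂ ≤ T) : optGap M γ ψ F θ₀ θs α₀ a T ≤ C * rate α₀ γ a T :=
    (h_mid (le_of_max_le_left hT)).trans (h_mid_rate T (le_of_max_le_right hT))
  refine ⟨?_, h_rate, fun ha ε hε hε' hT => ?_⟩
  · rcases lt_or_ge T (max T₁ T₂) with hT | hT
    · exact (optGap_le_const (hF.mono (le_max_left lF 0) le_rfl le_rfl) hγ0 hγ1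
        (le_max_right lF 0)).trans (h_few T hT)
    · exact (h_rate hT).trans (mul_le_mul_of_nonneg_right hCK (h_pos T).le)
  · exact (h_mid ((h_count ⟨hε, hε'⟩ ha).2.trans hT)).trans
      (rpow_neg_midExponent_le_of_iterationCount_le ha hε hT)

open NVRPG in
theorem mainTheorem2 (lψ Lψ lF LF LFinf ℓ : ℝ) (hlψ : 0 < lψ) (hLψ : 0 < Lψ) (hlF : 0 < lF)
    (hLF : 0 < LF) (hLFinf : 0 < LFinf) (hℓ : 0 < ℓ) :
    ∃ C : ℝ, 0 < C ∧
      ∀ a γ α₀ : ℝ, 0 < a → a < 1 → 0 < γ → γ < 1 → 0 < α₀ →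
      ∃ (K : ℝ) (T₀ : ℕ) (ε₀ : ℝ) (Tε : ℝ → ℕ), 0 < K ∧ 0 < ε₀ ∧
        (3 / 4 < a → ∀ ε : ℝ, 0 < ε → ε ≤ ε₀ →
          (Tε ε : ℝ) * (horizon γ (Tε ε) : ℝ) ≤ C * ε ^ (-2 / (4 * a - 3))) ∧
        ∀ (S A : Type*) [Fintype S] [Fintype A] [DecidableEq S] [DecidableEq A] [Nonempty A]
          (M : MDP S A) (d : ℕ) (ψ : S → A → Param d → ℝ) (F : SAVec S A → ℝ)
          (θ₀ θs : Param d) (Θ : Set (Param d)) (εbar : ℝ) (T : ℕ),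
          1 ≤ T →
          PolicyRegular ψ lψ Lψ →
          UtilityRegular F lF LF LFinf →
          ConcaveOn ℝ (convexHull ℝ (M.occupancySet γ)) F →
          (∀ θ, F (occ M γ ψ θ) ≤ F (occ M γ ψ θs)) →
          IteratesIn M γ ψ F θ₀ α₀ a T Θ →
          LocallyInvertible M γ ψ θs Θ ℓ εbar →
          α₀ * (1 - γ) / (2 * ℓ * ((T : ℝ) + 1) ^ a) ≤ εbar →
          optGap M γ ψ F θ₀ θs α₀ a T ≤ K * rate α₀ γ a T ∧
          (T₀ ≤ T → optGap M γ ψ F θ₀ θs α₀ a T ≤ C * rate α₀ γ a T) ∧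
          (3 / 4 < a → α₀ = (1 - γ) ^ (3 / 2 : ℝ) →
            ∀ ε : ℝ, 0 < ε → ε ≤ ε₀ → Tε ε ≤ T → optGap M γ ψ F θ₀ θs α₀ a T ≤ ε) := by
  refine ⟨1, one_pos, fun a γ α₀ ha0 ha1 hγ0 hγ1 hα₀ => ?_⟩
  obtain ⟨K, T₀, ε₀, Tε, hK, hε₀, h_cost, h_gap⟩ :=
    mainTheorem2_general lψ Lψ lF LF LFinf hℓ one_pos ha0 ha1 hγ0.le hγ1 hα₀
  refine ⟨K, T₀, ε₀, Tε, hK, hε₀, h_cost, fun S A _ _ _ _ _ M d ψ F θ₀ θs Θ εbar T _ hψ hF hconc _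
    hit hinv hεbar => (h_gap S A M d ψ F θ₀ θs Θ εbar T hψ hF hconc hit hinv hεbar).imp_right
      (And.imp_right fun h_ε ha _ => h_ε ha)⟩
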